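/- Let $N$ be a compact smooth $d$-manifold and let $C$ be a riemannian gerbe on $N$ with typical fibre $\mathbb R^r$: a sheaf of groupoids $U\mapsto C(U)$ whose objects are smooth rank-$r$ vector bundles over $U$ and whose arrows are isomorphisms of vector bundles, with restriction functors given by restriction of bundles, such that objects and arrows glue, objects exist locally, any two objects are locally isomorphic, and the automorphisms of the objects are the sections of a sheaf of commutative groups (the band); moreover each object carries a smooth riemannian metric, preserved by arrows and restrictions. An operator $D$ of degree $n\in\mathbb R$ on $C$ is a family of linear operators $D_e:\Gamma(e)\to\Gamma(e)$ on the smooth sections of $e$, one for each object $e$ of each $C(U)$, such that (i) each $D_e$ is a pseudo-differential operator of degree $n$: near each point of $U$, in a chart and a trivialization of $e$ over a neighbourhood $W$, and for sections $s$ with compact support in $W$, $(D_es)_k(x)=\sum_l\int p_{kl}(x,\xi)\,\hat s_l(\xi)\,e^{2\pi i\langle x,\xi\rangle}\,d\xi$ over $W$, where the $p_{kl}$ are smooth, satisfy $|\partial_\xi^\alpha\partial_x^\beta p_{kl}(x,\xi)|\le C_{\alpha,\beta,K}(1+|\xi|)^{n-|\alpha|}$ for $x$ in any compact $K\subset W$,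 and are such that $\lim_{t\to\infty}p_{kl}(x,t\xi)/t^n$ exists for $\xi\neq0$; (ii) $D_f\circ g=g\circ D_e$ for each arrow $g:e\to f$; (iii) the operators commute with restriction: $D_{e|_V}(s|_V)=(D_es)|_V$ for $V\subset U$. A chain $(g_{ij})$ consists of an open covering $(U_i)_{i\in I}$ of $N$, objects $e_i$ of $C(U_i)$ and arrows $g_{ij}:e_j|_{U_i\cap U_j}\to e_i|_{U_i\cap U_j}$ (no cocycle condition). Its space of global sections $S(g_{ij})$ is the vector space of the families $(s_i)_{i\in I}$ of smooth sections $s_i$ of $e_i$ with $s_i=g_{ij}(s_j)$ on $U_i\cap U_j$. For $s\in\mathbb R$ let $H_s(S(g_{ij}))$ be the completion of $S(g_{ij})$ for the Sobolev topology of order $s$, defined by the seminorms $u\mapsto\|\chi u_i\|_{H^s(\mathbb R^d)}=\big(\int(1+|\xi|^2)^s\,|\widehat{\chi u_i}(\xi)|^2\,d\xi\big)^{1/2}$, where $\chi$ is a smooth function with compact support in the common domain of a chart of $U_i$ and a trivialization of $e_i$, in which $\chi u_i$ is written. Let $H_s(L)=\bigoplus_{(g_{ij})}H_s(S(g_{ij}))$,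 the sum over all chains, be the space of formal finite sums $[u_1]+\dots+[u_k]$ of elements of the spaces $H_s(S(g_{ij}))$. Then for every $s\in\mathbb R$: (a) for every chain $(g_{ij})$ and every $(u_i)_{i\in I}\in S(g_{ij})$ the family $(D_{e_i}u_i)_{i\in I}$ belongs to $S(g_{ij})$, and $(u_i)\mapsto(D_{e_i}u_i)$ extends uniquely to a continuous linear map $D_{S(g_{ij})}:H_s(S(g_{ij}))\to H_{s-n}(S(g_{ij}))$; (b) there is a unique linear map $D_L:H_s(L)\to H_{s-n}(L)$ such that $D_L[u]=[D_{S(g_{ij})}u]$ for every chain $(g_{ij})$ and every $u\in H_s(S(g_{ij}))$. -/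

import Mathlib

open Set Filter Topology MeasureTheory Bundle TopologicalSpace
open scoped Manifold ContDiff FourierTransform SchwartzMap DirectSum

noncomputable section

namespace GerbeOp

universe u v

/-- The model space `ℝ^d` of the base manifold, which is also the space of covectors. -/
abbrev Model (d : ℕ) : Type := EuclideanSpace ℝ (Fin d)

/-- The typical fibre, a real vector space of dimension `r`. -/
abbrev Fib (r : ℕ) : Type := EuclideanSpace ℝ (Fin r)

/-! ### Smooth vector bundles, their isomorphisms and their sections -/

section Bundles

variable {d : ℕ} (r : ℕ) (M : Type u) [TopologicalSpace M] [ChartedSpace (Model d) M]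

/-- A smooth real vector bundle of rank `r` over the `d`-manifold `M`. -/
structure VBundle (d r : ℕ) (M : Type u) [TopologicalSpace M] [ChartedSpace (Model d) M] :
    Type (u + 1) where
  /-- the fibre over a point -/
  Fiber : M → Type u
  [addCommGroup : ∀ x, AddCommGroup (Fiber x)]
  [module : ∀ x, Module ℝ (Fiber x)]
  [fiberTopology : ∀ x, TopologicalSpace (Fiber x)]
  [totalTopology : TopologicalSpace (TotalSpace (Fib r) Fiber)]
  [fiberBundle : FiberBundle (Fib r) Fiber]
  [vectorBundle : VectorBundle ℝ (Fib r) Fiber]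
  [smoothBundle : ContMDiffVectorBundle ∞ (Fib r) Fiber (𝓡 d)]

attribute [instance] VBundle.addCommGroup VBundle.module VBundle.fiberTopology
  VBundle.totalTopology VBundle.fiberBundle VBundle.vectorBundle VBundle.smoothBundle

variable {r M}

/-- The total space of a bundle. -/
abbrev VBundle.Total (A : VBundle d r M) : Type u := TotalSpace (Fib r) A.Fiber

/-- The real vector space of smooth sections of a bundle. -/
abbrev VBundle.Sections (A : VBundle d r M) : Type u :=
  ContMDiffSection (𝓡 d) (Fib r) ∞ A.Fiber

/-- An isomorphism of smooth vector bundles over the identity of `M`. -/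
structure BundleIso (A B : VBundle d r M) where
  /-- the linear isomorphisms between the fibres -/
  app : ∀ x, A.Fiber x ≃L[ℝ] B.Fiber x
  smooth : ContMDiff ((𝓡 d).prod 𝓘(ℝ, Fib r)) ((𝓡 d).prod 𝓘(ℝ, Fib r)) ∞
    (fun p : A.Total => (⟨p.1, app p.1 p.2⟩ : B.Total))
  smooth_symm : ContMDiff ((𝓡 d).prod 𝓘(ℝ, Fib r)) ((𝓡 d).prod 𝓘(ℝ, Fib r)) ∞
    (fun p : B.Total => (⟨p.1, (app p.1).symm p.2⟩ : A.Total))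

/-- The identity of a bundle. -/
def BundleIso.refl (A : VBundle d r M) : BundleIso A A where
  app x := ContinuousLinearEquiv.refl ℝ (A.Fiber x)
  smooth := contMDiff_id
  smooth_symm := contMDiff_id

/-- The inverse of an isomorphism of bundles. -/
def BundleIso.symm {A B : VBundle d r M} (g : BundleIso A B) : BundleIso B A where
  app x := (g.app x).symm
  smooth := g.smooth_symm
  smooth_symm := g.smooth

/-- The composite of two isomorphisms of bundles: first `g`, then `h`. -/
def BundleIso.trans {A B C : VBundle d r M} (g : BundleIso A B) (h : BundleIso B C) :
    BundleIso A C where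
  app x := (g.app x).trans (h.app x)
  smooth := h.smooth.comp g.smooth
  smooth_symm := g.smooth_symm.comp h.smooth_symm

end Bundles

/-- Data that exhibit the bundle `B` over `V` as the restriction to `V` of the bundle `A` over
`U`: a smooth bundle map which covers the inclusion and is an isomorphism on each fibre. -/
structure RestrictionIso {d r : ℕ} {N : Type u} [TopologicalSpace N] [ChartedSpace (Model d) N]
    {U V : Opens N} (h : V ≤ U) (B : VBundle d r V) (A : VBundle d r U) where
  /-- the identification of the fibres -/
  app : ∀ x : V, B.Fiber x ≃L[ℝ] A.Fiber ⟨x.1, h x.2⟩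
  smooth : ContMDiff ((𝓡 d).prod 𝓘(ℝ, Fib r)) ((𝓡 d).prod 𝓘(ℝ, Fib r)) ∞
    (fun p : B.Total => (⟨⟨p.1.1, h p.1.2⟩, app p.1 p.2⟩ : A.Total))

/-! ### Riemannian gerbes -/

/-- For each open subset `U` of `N` a groupoid whose objects are (labels of) vector bundles over
`U` with typical fibre `ℝ^r` and whose arrows are isomorphisms of vector bundles, with
restriction functors which are the restriction of bundles and of bundle isomorphisms.
Restrictions compose up to the evident identification of bundles. -/
structure BundlePrestack (d r : ℕ) (N : Type u) [TopologicalSpace N]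
    [ChartedSpace (Model d) N] where
  /-- the objects over an open set -/
  Obj : Opens N → Type v
  /-- the bundle that an object is -/
  bundle : ∀ {U : Opens N}, Obj U → VBundle d r U
  /-- the arrows: some of the isomorphisms of bundles -/
  Hom : ∀ {U : Opens N} (e f : Obj U), Set (BundleIso (bundle e) (bundle f))
  refl_mem : ∀ {U : Opens N} (e : Obj U), BundleIso.refl (bundle e) ∈ Hom e e
  symm_mem : ∀ {U : Opens N} {e f : Obj U} {g}, g ∈ Hom e f → g.symm ∈ Hom f e
  trans_mem : ∀ {U : Opens N} {e f k : Obj U} {g h}, g ∈ Hom e f → h ∈ Hom f k →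
    g.trans h ∈ Hom e k
  /-- the restriction of objects -/
  res : ∀ {U V : Opens N}, V ≤ U → Obj U → Obj V
  /-- the bundle of the restriction is the restriction of the bundle -/
  resIso : ∀ {U V : Opens N} (h : V ≤ U) (e : Obj U),
    RestrictionIso h (bundle (res h e)) (bundle e)
  /-- the restriction of an arrow is an arrow -/
  res_hom : ∀ {U V : Opens N} (h : V ≤ U) {e f : Obj U}, ∀ g ∈ Hom e f,
    ∃ k ∈ Hom (res h e) (res h f), ∀ (x : V) (w : (bundle (res h e)).Fiber x),
      (resIso h f).app x (k.app x w) = g.app ⟨x.1, h x.2⟩ ((resIso h e).app x w)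
  res_refl : ∀ {U : Opens N} (e : Obj U),
    ∃ k ∈ Hom (res le_rfl e) e, ∀ (x : U) (w : (bundle (res le_rfl e)).Fiber x),
      k.app x w = (resIso le_rfl e).app x w
  res_res : ∀ {U V W : Opens N} (h : V ≤ U) (h' : W ≤ V) (e : Obj U),
    ∃ k ∈ Hom (res h' (res h e)) (res (h'.trans h) e),
      ∀ (x : W) (w : (bundle (res h' (res h e))).Fiber x),
        (resIso (h'.trans h) e).app x (k.app x w) =
          (resIso h e).app ⟨x.1, h' x.2⟩ ((resIso h' (res h e)).app x w)

namespace BundlePrestack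

variable {d r : ℕ} {N : Type u} [TopologicalSpace N] [ChartedSpace (Model d) N]

/-- An isomorphism between the restrictions to `W` of `e` and `f`, read as an isomorphism from
the fibre of `e` to the fibre of `f` at a point of `W`. -/
def onFiber (C : BundlePrestack.{u, v} d r N) {U V W : Opens N} (hU : W ≤ U) (hV : W ≤ V)
    {e : C.Obj U} {f : C.Obj V} (g : BundleIso (C.bundle (C.res hU e)) (C.bundle (C.res hV f)))
    (x : N) (hx : x ∈ W) :
    (C.bundle e).Fiber ⟨x, hU hx⟩ ≃L[ℝ] (C.bundle f).Fiber ⟨x, hV hx⟩ :=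
  (((C.resIso hU e).app ⟨x, hx⟩).symm.trans (g.app ⟨x, hx⟩)).trans ((C.resIso hV f).app ⟨x, hx⟩)

end BundlePrestack

/-- A vectorial gerbe on `N` with typical fibre `ℝ^r` and commutative band. -/
structure VectorialGerbe (d r : ℕ) (N : Type u) [TopologicalSpace N] [ChartedSpace (Model d) N]
    extends BundlePrestack.{u, v} d r N where
  /-- Gluing of arrows. Isomorphisms of bundles glue, so that the arrows between `e` and `f` form
  a sheaf if and only if an isomorphism of bundles is an arrow as soon as it is one locally. -/
  glue_hom : ∀ {U : Opens N} {e f : Obj U} (g : BundleIso (bundle e) (bundle f)),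
    (∀ x ∈ U, ∃ (V : Opens N) (h : V ≤ U), x ∈ V ∧ ∃ k ∈ Hom (res h e) (res h f),
      ∀ (y : V) (w : (bundle (res h e)).Fiber y),
        (resIso h f).app y (k.app y w) = g.app ⟨y.1, h y.2⟩ ((resIso h e).app y w)) →
    g ∈ Hom e f
  /-- Gluing of objects. -/
  glue_obj : ∀ {ι : Type u} (U : ι → Opens N) (e : ∀ i, Obj (U i))
    (g : ∀ i j, BundleIso (bundle (res (inf_le_right : U i ⊓ U j ≤ U j) (e j)))
      (bundle (res (inf_le_left : U i ⊓ U j ≤ U i) (e i)))),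
    (∀ i j, g i j ∈ Hom _ _) →
    (∀ (i j k : ι) (x : N) (hi : x ∈ U i) (hj : x ∈ U j) (hk : x ∈ U k)
      (w : (bundle (e k)).Fiber ⟨x, hk⟩),
      toBundlePrestack.onFiber inf_le_right inf_le_left (g i j) x ⟨hi, hj⟩
        (toBundlePrestack.onFiber inf_le_right inf_le_left (g j k) x ⟨hj, hk⟩ w) =
      toBundlePrestack.onFiber inf_le_right inf_le_left (g i k) x ⟨hi, hk⟩ w) →
    ∃ (E : Obj (⨆ i, U i)) (f : ∀ i, BundleIso (bundle (res (le_iSup U i) E)) (bundle (e i))),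
      (∀ i, f i ∈ Hom _ _) ∧
      ∀ (i j : ι) (x : N) (hi : x ∈ U i) (hj : x ∈ U j)
        (w : (bundle E).Fiber ⟨x, le_iSup U i hi⟩),
        toBundlePrestack.onFiber inf_le_right inf_le_left (g i j) x ⟨hi, hj⟩
          ((f j).app ⟨x, hj⟩ (((resIso (le_iSup U j) E).app ⟨x, hj⟩).symm w)) =
        (f i).app ⟨x, hi⟩ (((resIso (le_iSup U i) E).app ⟨x, hi⟩).symm w)
  /-- Objects exist locally. -/
  locally_nonempty : ∀ x : N, ∃ U : Opens N, x ∈ U ∧ Nonempty (Obj U)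
  /-- Two objects are locally isomorphic. -/
  locally_iso : ∀ {U : Opens N} (e f : Obj U), ∀ x ∈ U, ∃ (V : Opens N) (h : V ≤ U),
    x ∈ V ∧ (Hom (res h e) (res h f)).Nonempty
  /-- The band: a sheaf of commutative groups. -/
  band : TopCat.Sheaf CommGrpCat.{u} (TopCat.of N)
  /-- The automorphisms of an object over `U` are the sections of the band over `U`. -/
  bandEquiv : ∀ {U : Opens N} (e : Obj U), band.presheaf.obj (Opposite.op U) ≃ Hom e e
  bandEquiv_mul : ∀ {U : Opens N} (e : Obj U) (a b : band.presheaf.obj (Opposite.op U)),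
    (bandEquiv e (a * b)).1 = (bandEquiv e b).1.trans (bandEquiv e a).1
  /-- The identification of the automorphisms with the band commutes with restriction. -/
  bandEquiv_res : ∀ {U V : Opens N} (h : V ≤ U) (e : Obj U)
    (a : band.presheaf.obj (Opposite.op U)) (x : V) (w : (bundle (res h e)).Fiber x),
    (resIso h e).app x
        ((bandEquiv (res h e) (band.presheaf.map (CategoryTheory.homOfLE h).op a)).1.app x w) =
      (bandEquiv e a).1.app ⟨x.1, h x.2⟩ ((resIso h e).app x w)

/-- A riemannian gerbe: a vectorial gerbe with a riemannian metric on each object which the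
arrows and the restrictions preserve. -/
structure RiemannianGerbe (d r : ℕ) (N : Type u) [TopologicalSpace N] [ChartedSpace (Model d) N]
    extends VectorialGerbe.{u, v} d r N where
  /-- the riemannian metric of an object -/
  metric : ∀ {U : Opens N} (e : Obj U),
    ContMDiffRiemannianMetric (𝓡 d) ∞ (Fib r) (bundle e).Fiber
  metric_hom : ∀ {U : Opens N} {e f : Obj U}, ∀ g ∈ Hom e f, ∀ (x : U)
    (w w' : (bundle e).Fiber x),
    (metric f).inner x (g.app x w) (g.app x w') = (metric e).inner x w w'
  metric_res : ∀ {U V : Opens N} (h : V ≤ U) (e : Obj U) (x : V)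
    (w w' : (bundle (res h e)).Fiber x),
    (metric e).inner ⟨x.1, h x.2⟩ ((resIso h e).app x w) ((resIso h e).app x w') =
      (metric (res h e)).inner x w w'

/-! ### Pseudo-differential operators -/

/-- The inclusion of `ℝ^r` into `ℂ^r`. -/
def complexify (r : ℕ) : Fib r →L[ℝ] EuclideanSpace ℂ (Fin r) :=
  LinearMap.toContinuousLinearMap
    { toFun := fun w => WithLp.toLp 2 (fun k => ((w k : ℝ) : ℂ))
      map_add' := fun w w' => by ext k; simp
      map_smul' := fun c w => by ext k; simp }

/-- `p` is a symbol of order `m` on `Ω × ℝ^d`: it is smooth and satisfies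
`|∂_ξ^a ∂_x^b p (x, ξ)| ≤ C (1 + |ξ|)^(m - a)`, locally uniformly in `x`. -/
def IsSymbol {d : ℕ} (m : ℝ) (Ω : Set (Model d)) (p : Model d → Model d → ℂ) : Prop :=
  ContDiffOn ℝ ∞ (fun z : Model d × Model d => p z.1 z.2) (Ω ×ˢ univ) ∧
  ∀ K : Set (Model d), IsCompact K → K ⊆ Ω → ∀ a b : ℕ, ∃ c : ℝ, ∀ x ∈ K, ∀ ξ : Model d,
    ‖iteratedFDeriv ℝ a (fun η => iteratedFDeriv ℝ b (fun y => p y η) x) ξ‖ ≤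
      c * (1 + ‖ξ‖) ^ (m - a)

/-- The symbol `p` has a principal part of degree `m`: the limit of `p (x, t ξ) / t^m` as
`t → ∞` exists for every `x ∈ Ω` and every covector `ξ ≠ 0`. -/
def HasPrincipalPart {d : ℕ} (m : ℝ) (Ω : Set (Model d)) (p : Model d → Model d → ℂ) : Prop :=
  ∀ x ∈ Ω, ∀ ξ : Model d, ξ ≠ 0 →
    ∃ l : ℂ, Tendsto (fun t : ℝ => p x (t • ξ) / ((t ^ m : ℝ) : ℂ)) atTop (𝓝 l)

section Local

variable {d r : ℕ} {M : Type u} [TopologicalSpace M] [ChartedSpace (Model d) M]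

open Classical in
/-- The components of a section in a chart `φ` and a local trivialization `t`, as a function on
the whole of `ℝ^d`; it is zero where the chart and the trivialization are not both defined. -/
def coordinates (A : VBundle d r M) (φ : OpenPartialHomeomorph M (Model d))
    (t : Trivialization (Fib r) (TotalSpace.proj : A.Total → M)) (s : A.Sections)
    (z : Model d) : EuclideanSpace ℂ (Fin r) :=
  if z ∈ φ.target ∧ φ.symm z ∈ t.baseSet then
    complexify r (t ⟨φ.symm z, s (φ.symm z)⟩).2 else 0

/-- The operator `P` on the smooth sections of `A` is pseudo-differential of degree `m`: each
point has a neighbourhood `W`, contained in the domain of a chart `φ` and of a trivialization `t`,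
such that on the sections with compact support in `W` the operator is given over `W` by
`(P s)_k (x) = ∑_l ∫ p_kl(x, ξ) ŝ_l(ξ) e^(2 π i ⟨x, ξ⟩) dξ`, with symbols `p_kl` of degree `m`. -/
def IsPseudoDiff (m : ℝ) (A : VBundle d r M) (P : A.Sections →ₗ[ℝ] A.Sections) : Prop :=
  ∀ x : M, ∃ φ ∈ IsManifold.maximalAtlas (𝓡 d) ∞ M,
    ∃ t ∈ trivializationAtlas (Fib r) A.Fiber, ∃ W : Set M,
    IsOpen W ∧ x ∈ W ∧ W ⊆ φ.source ∩ t.baseSet ∧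
    ∃ p : Fin r → Fin r → Model d → Model d → ℂ,
      (∀ k l, IsSymbol m (φ '' W) (p k l) ∧ HasPrincipalPart m (φ '' W) (p k l)) ∧
      ∀ s : A.Sections, (∃ K : Set M, IsCompact K ∧ K ⊆ W ∧ ∀ y ∉ K, s y = 0) →
        ∀ y ∈ W, ∀ k : Fin r,
          coordinates A φ t (P s) (φ y) k =
            ∑ l : Fin r, ∫ ξ : Model d,
              p k l (φ y) ξ * 𝓕 (fun z => coordinates A φ t s z l) ξ *
                Complex.exp (2 * Real.pi * Complex.I * (inner ℝ (φ y) ξ : ℝ))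

end Local

/-- An operator of degree `m` on a riemannian gerbe: on each object a pseudo-differential
operator of degree `m` which maps smooth sections to smooth sections, such that these operators
commute with the arrows and with the restrictions to smaller open sets. -/
structure RiemannianGerbe.Operator {d r : ℕ} {N : Type u} [TopologicalSpace N]
    [ChartedSpace (Model d) N] (C : RiemannianGerbe.{u, v} d r N) (m : ℝ) where
  /-- the operator on an object -/
  op : ∀ {U : Opens N} (e : C.Obj U), (C.bundle e).Sections →ₗ[ℝ] (C.bundle e).Sections
  pseudoDiff : ∀ {U : Opens N} (e : C.Obj U), IsPseudoDiff m (C.bundle e) (op e)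
  /-- if `t = g s` for an arrow `g`, then `D t = g (D s)` -/
  comm_hom : ∀ {U : Opens N} {e f : C.Obj U}, ∀ g ∈ C.Hom e f,
    ∀ (s : (C.bundle e).Sections) (t : (C.bundle f).Sections),
      (∀ x, t x = g.app x (s x)) → ∀ x, op f t x = g.app x (op e s x)
  /-- if `t` is the restriction of `s`, then `D t` is the restriction of `D s` -/
  comm_res : ∀ {U V : Opens N} (h : V ≤ U) (e : C.Obj U)
    (s : (C.bundle e).Sections) (t : (C.bundle (C.res h e)).Sections),
      (∀ x : V, (C.resIso h e).app x (t x) = s ⟨x.1, h x.2⟩) →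
      ∀ x : V, (C.resIso h e).app x (op (C.res h e) t x) = op e s ⟨x.1, h x.2⟩

/-! ### Global sections -/

/-- A chain `(g_ij)` of a gerbe: an open covering `(U_i)` of `N`, an object `e_i` over each `U_i`
and arrows `g_ij` from the restriction of `e_j` to the restriction of `e_i` over `U_i ∩ U_j`. -/
structure VectorialGerbe.Chain {d r : ℕ} {N : Type u} [TopologicalSpace N]
    [ChartedSpace (Model d) N] (C : VectorialGerbe.{u, v} d r N) where
  ι : Type u
  U : ι → Opens N
  cover : ∀ x : N, ∃ i, x ∈ U i
  e : ∀ i, C.Obj (U i)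
  g : ∀ i j, BundleIso (C.bundle (C.res (inf_le_right : U i ⊓ U j ≤ U j) (e j)))
    (C.bundle (C.res (inf_le_left : U i ⊓ U j ≤ U i) (e i)))
  g_mem : ∀ i j, g i j ∈ C.Hom _ _

namespace VectorialGerbe.Chain

variable {d r : ℕ} {N : Type u} [TopologicalSpace N] [ChartedSpace (Model d) N]
  {C : VectorialGerbe.{u, v} d r N}

/-- The vector space `S(g_ij)` of global sections associated to a chain: the families of smooth
sections `s_i` of `e_i` such that `s_i = g_ij (s_j)` on `U_i ∩ U_j`. -/
def globalSections (G : C.Chain) : Submodule ℝ (∀ i, (C.bundle (G.e i)).Sections) where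
  carrier := {s | ∀ (i j : G.ι) (x : N) (hi : x ∈ G.U i) (hj : x ∈ G.U j),
    s i ⟨x, hi⟩ = C.onFiber inf_le_right inf_le_left (G.g i j) x ⟨hi, hj⟩ (s j ⟨x, hj⟩)}
  add_mem' := by
    intro s t hs ht i j x hi hj
    have h1 := hs i j x hi hj
    have h2 := ht i j x hi hj
    simp only [Pi.add_apply, ContMDiffSection.coe_add, map_add] at h1 h2 ⊢
    rw [← h1, ← h2]
  zero_mem' := by
    intro i j x hi hj
    simp
  smul_mem' := by
    intro c s hs i j x hi hj
    have h1 := hs i j x hi hj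
    simp only [Pi.smul_apply, ContMDiffSection.coe_smul, map_smul] at h1 ⊢
    rw [← h1]

end VectorialGerbe.Chain

/-! ### Sobolev spaces -/

section Sobolev

variable {d r : ℕ} {M : Type u} [TopologicalSpace M] [ChartedSpace (Model d) M]

/-- A localization on a bundle `A`: a smooth chart `φ` of the base, a local trivialization `t` of
`A` and a smooth function `χ` with compact support in the common domain of `φ` and `t`. -/
structure Localization (A : VBundle d r M) where
  φ : OpenPartialHomeomorph M (Model d)
  φ_mem : φ ∈ IsManifold.maximalAtlas (𝓡 d) ∞ M
  t : Trivialization (Fib r) (TotalSpace.proj : A.Total → M)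
  t_mem : t ∈ trivializationAtlas (Fib r) A.Fiber
  χ : M → ℝ
  smooth : ContMDiff (𝓡 d) 𝓘(ℝ, ℝ) ∞ χ
  hasCompactSupport : HasCompactSupport χ
  tsupport_subset : tsupport χ ⊆ φ.source ∩ t.baseSet

/-- The components of `χ s` in the chart and the trivialization of a localization. -/
def Localization.toFun {A : VBundle d r M} (a : Localization A) (s : A.Sections)
    (z : Model d) : EuclideanSpace ℂ (Fin r) :=
  a.χ (a.φ.symm z) • coordinates A a.φ a.t s z

theorem Localization.toFun_eq_zero {A : VBundle d r M} (a : Localization A) (s : A.Sections)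
    (z : Model d) (hz : z ∉ a.φ '' tsupport a.χ) : a.toFun s z = 0 := by
  unfold Localization.toFun coordinates
  split_ifs with h
  · have : a.χ (a.φ.symm z) = 0 := by
      by_contra h0
      exact hz ⟨a.φ.symm z, subset_tsupport _ h0, a.φ.right_inv h.1⟩
    rw [this, zero_smul]
  · simp

theorem Localization.isCompact_image {A : VBundle d r M} (a : Localization A) :
    IsCompact (a.φ '' tsupport a.χ) :=
  IsCompact.image_of_continuousOn a.hasCompactSupport
    (a.φ.continuousOn.mono (a.tsupport_subset.trans inter_subset_left))

theorem Localization.hasCompactSupport_toFun {A : VBundle d r M} (a : Localization A)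
    (s : A.Sections) : HasCompactSupport (a.toFun s) :=
  HasCompactSupport.intro a.isCompact_image (fun z hz => a.toFun_eq_zero s z hz)

theorem Localization.contDiff_toFun {A : VBundle d r M} (a : Localization A)
    (s : A.Sections) : ContDiff ℝ ∞ (a.toFun s) := by
  have : MemTrivializationAtlas a.t := ⟨a.t_mem⟩
  rw [contDiff_iff_contDiffAt]
  intro z
  by_cases hz : z ∈ a.φ '' tsupport a.χ
  · obtain ⟨y, hy, rfl⟩ := hz
    obtain ⟨hyφ, hyt⟩ := a.tsupport_subset hy
    have hz : a.φ y ∈ a.φ.target := a.φ.map_source hyφ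
    have hsymm : a.φ.symm (a.φ y) = y := a.φ.left_inv hyφ
    have h1 : ContMDiffAt (𝓡 d) (𝓡 d) ∞ a.φ.symm (a.φ y) :=
      contMDiffAt_symm_of_mem_maximalAtlas a.φ_mem hz
    have h2 : ContMDiffAt (𝓡 d) 𝓘(ℝ, Fib r) ∞ (fun x => (a.t ⟨x, s x⟩).2)
        (a.φ.symm (a.φ y)) := by
      rw [hsymm]
      exact (a.t.contMDiffAt_section_iff hyt).1 s.contMDiff.contMDiffAt
    have h3 : ContMDiffAt (𝓡 d) 𝓘(ℝ, Fib r) ∞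
        (fun z => (a.t ⟨a.φ.symm z, s (a.φ.symm z)⟩).2) (a.φ y) := h2.comp _ h1
    have h4 : ContMDiffAt (𝓡 d) 𝓘(ℝ, ℝ) ∞ (fun z => a.χ (a.φ.symm z)) (a.φ y) :=
      a.smooth.contMDiffAt.comp _ h1
    have h5 := h4.contDiffAt.smul ((complexify r).contDiff.contDiffAt.comp _ h3.contDiffAt)
    refine h5.congr_of_eventuallyEq ?_
    have e1 : ∀ᶠ z in 𝓝 (a.φ y), z ∈ a.φ.target := a.φ.open_target.mem_nhds hz
    have e2 : ∀ᶠ z in 𝓝 (a.φ y), a.φ.symm z ∈ a.t.baseSet :=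
      (a.φ.symm.continuousAt (by simpa using hz)).eventually
        (a.t.open_baseSet.mem_nhds (by rw [hsymm]; exact hyt))
    filter_upwards [e1, e2] with z hz1 hz2
    simp [Localization.toFun, coordinates, hz1, hz2]
  · have h0 : a.toFun s =ᶠ[𝓝 z] fun _ => 0 := by
      filter_upwards [a.isCompact_image.isClosed.isOpen_compl.mem_nhds hz] with w hw
      exact a.toFun_eq_zero s w hw
    exact contDiffAt_const.congr_of_eventuallyEq h0

/-- The map `s ↦ χ s`, written in the chart and the trivialization of a localization, from smooth
sections to (compactly supported) Schwartz functions on `ℝ^d` with values in `ℂ^r`. -/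
def Localization.toSchwartz {A : VBundle d r M} (a : Localization A) :
    A.Sections →ₗ[ℝ] 𝓢(Model d, EuclideanSpace ℂ (Fin r)) where
  toFun s := (a.hasCompactSupport_toFun s).toSchwartzMap (a.contDiff_toFun s)
  map_add' s s' := by
    have : MemTrivializationAtlas a.t := ⟨a.t_mem⟩
    ext1 z
    change a.toFun (s + s') z = a.toFun s z + a.toFun s' z
    unfold Localization.toFun coordinates
    split_ifs with h
    · have := (a.t.linear ℝ h.2).map_add (s (a.φ.symm z)) (s' (a.φ.symm z))
      rw [ContMDiffSection.coe_add, Pi.add_apply, this, map_add, smul_add]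
    · simp
  map_smul' c s := by
    have : MemTrivializationAtlas a.t := ⟨a.t_mem⟩
    ext1 z
    change a.toFun (c • s) z = c • a.toFun s z
    unfold Localization.toFun coordinates
    split_ifs with h
    · have := (a.t.linear ℝ h.2).map_smul c (s (a.φ.symm z))
      rw [ContMDiffSection.coe_smul, Pi.smul_apply, this, map_smul, smul_comm]
    · simp

/-- The space `L²(ℝ^d; ℂ^r)`. -/
abbrev L2 (d r : ℕ) : Type := Lp (EuclideanSpace ℂ (Fin r)) 2 (volume : Measure (Model d))

/-- The Bessel potential `f ↦ 𝓕⁻¹ ((1 + |ξ|²)^(s/2) 𝓕 f)`, from Schwartz functions to `L²`. The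
`L²` norm of its value at `f` is the Sobolev norm of order `s` of `f`. -/
def bessel (d r : ℕ) (s : ℝ) :
    𝓢(Model d, EuclideanSpace ℂ (Fin r)) →ₗ[ℝ] L2 d r :=
  ((SchwartzMap.toLpCLM ℂ (EuclideanSpace ℂ (Fin r)) 2 (volume : Measure (Model d))).comp
    (SchwartzMap.fourierMultiplierCLM (EuclideanSpace ℂ (Fin r))
      (fun ξ : Model d => (((1 + ‖ξ‖ ^ 2) ^ (s / 2) : ℝ) : ℂ)))).toLinearMap.restrictScalars ℝ

end Sobolev

namespace VectorialGerbe.Chain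

variable {d r : ℕ} {N : Type u} [TopologicalSpace N] [ChartedSpace (Model d) N]
  {C : VectorialGerbe.{u, v} d r N}

/-- All localizations of all the objects `e_i` of a chain. -/
abbrev Localizations (G : C.Chain) : Type u := Σ i : G.ι, Localization (C.bundle (G.e i))

/-- A global section `(u_i)` is sent to the family of the Bessel potentials of order `s` of all
the localizations of the sections `u_i`. -/
def sobolevMap (G : C.Chain) (s : ℝ) :
    G.globalSections →ₗ[ℝ] (G.Localizations → L2 d r) :=
  LinearMap.pi fun a =>
    ((bessel d r s ∘ₗ a.2.toSchwartz) ∘ₗ LinearMap.proj a.1) ∘ₗ G.globalSections.subtype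

/-- The vector space `S(g_ij)`, to be endowed with the Sobolev topology of order `s`. -/
def PreSobolev (G : C.Chain) (_s : ℝ) : Type u := G.globalSections

instance (G : C.Chain) (s : ℝ) : AddCommGroup (G.PreSobolev s) :=
  inferInstanceAs (AddCommGroup G.globalSections)

instance (G : C.Chain) (s : ℝ) : Module ℝ (G.PreSobolev s) :=
  inferInstanceAs (Module ℝ G.globalSections)

/-- The Sobolev uniform structure of order `s` on `S(g_ij)`: it is defined by the seminorms
`u ↦ ‖χ u_i‖_{H^s(ℝ^d)}`, for all `i` and all localizations of `e_i`. -/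
instance (G : C.Chain) (s : ℝ) : UniformSpace (G.PreSobolev s) :=
  UniformSpace.comap (G.sobolevMap s) inferInstance

instance (G : C.Chain) (s : ℝ) : IsUniformAddGroup (G.PreSobolev s) :=
  IsUniformAddGroup.comap (G.sobolevMap s)

instance (G : C.Chain) (s : ℝ) : UniformContinuousConstSMul ℝ (G.PreSobolev s) :=
  haveI : UniformContinuousConstSMul ℝ (G.Localizations → L2 d r) :=
    ⟨fun c => uniformContinuous_pi.2 fun a =>
      (uniformContinuous_const_smul c).comp (Pi.uniformContinuous_proj _ a)⟩
  IsUniformInducing.uniformContinuousConstSMul (f := G.sobolevMap s) ⟨rfl⟩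
    (fun c x => map_smul (G.sobolevMap s) c x)

/-- The Sobolev space `H_s(S(g_ij))`: the completion of the space `S(g_ij)` of global sections
for the Sobolev topology of order `s`. -/
abbrev Sobolev (G : C.Chain) (s : ℝ) : Type u := UniformSpace.Completion (G.PreSobolev s)

/-- The class in `H_s(S(g_ij))` of a smooth global section. -/
def toSobolev (G : C.Chain) (s : ℝ) (w : G.globalSections) : G.Sobolev s :=
  ((show G.PreSobolev s from w) : UniformSpace.Completion (G.PreSobolev s))

end VectorialGerbe.Chain

/-- The space `H_s(L)` of formal global sections: the space of the formal finite sums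
`[s_1] + … + [s_k]` of elements of the spaces `H_s(S(g_ij))`, for all chains `(g_ij)`. Sections
of the same chain are added in `H_s(S(g_ij))`, and different chains are independent. -/
abbrev VectorialGerbe.FormalSobolev {d r : ℕ} {N : Type u} [TopologicalSpace N]
    [ChartedSpace (Model d) N] (C : VectorialGerbe.{u, v} d r N) (s : ℝ) :
    Type (max (u + 1) v) :=
  ⨁ G : C.Chain, G.Sobolev s

open Classical in
/-- The linear map `x ↦ [x]` from `H_s(S(g_ij))` to `H_s(L)`. -/
def VectorialGerbe.Chain.formal {d r : ℕ} {N : Type u} [TopologicalSpace N]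
    [ChartedSpace (Model d) N] {C : VectorialGerbe.{u, v} d r N} (G : C.Chain) (s : ℝ) :
    G.Sobolev s →ₗ[ℝ] C.FormalSobolev s :=
  DirectSum.lof ℝ C.Chain (fun G => G.Sobolev s) G

/-- The map `T` from `H_s(S(g_ij))` to `H_{s-m}(S(g_ij))` is induced by the operator `D`: for each
smooth global section `(u_i)` the family `(D u_i)` is a global section, and its class is the image
under `T` of the class of `(u_i)`. -/
def RiemannianGerbe.Operator.Induces {d r : ℕ} {N : Type u} [TopologicalSpace N]
    [ChartedSpace (Model d) N] {C : RiemannianGerbe.{u, v} d r N} {m : ℝ} (D : C.Operator m)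
    (G : C.Chain) (s : ℝ) (T : G.Sobolev s → G.Sobolev (s - m)) : Prop :=
  ∀ w : G.globalSections, ∃ w' : G.globalSections,
    (∀ i, w'.1 i = D.op (G.e i) (w.1 i)) ∧ T (G.toSobolev s w) = G.toSobolev (s - m) w'

end GerbeOp

end

noncomputable section

namespace GerbeOp

universe u v

/-! ### Sobolev estimates for Schwartz functions -/

/-! Commutation with restriction makes every `D_e` local: if two sections agree near a point, their
difference restricts to zero there (`isLocalOperator`). A local pseudo-differential operator `P` of
degree `n` is in fact a differential operator, of order at most `n` when `d > 0`.

The reason is a scaling argument. Let `s` vanish to order `m > n` at `z₀`. By locality `P s` at `z₀`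
does not change when `s` is cut off to a ball of radius comparable to `ε` about `z₀`. In the
integral formula the substitution `ξ = ζ/ε` leaves a factor `ε^m`, from the vanishing of `s`,
against a symbol that grows at most like `ε^(-n)`; letting `ε → 0` gives `P s = 0` at `z₀`
(`tendsto_integral_fourier_cutoff`, `IsPseudoDiff.apply_eq_zero`). Hence `P s` at `z₀` depends only
on the Taylor polynomial of degree less than `m`, and expanding this polynomial in monomials writes
`P` with coefficients which are values of `P` on cut-off monomials, hence smooth
(`IsPseudoDiff.exists_eq_sum_deriv`).

Such an operator is bounded from `H_s` to `H_{s-n}`: derivatives become multipliers dominated by the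
weight of order `n`, and multiplication by a Schwartz function is bounded on the whole Sobolev
scale, by Peetre's and Young's inequalities (`exists_norm_bessel_coeff_smul_deriv_le`).

Compatibility with arrows and restrictions makes `D` act on `S(g_ij)`; the estimates extend this
action to the completions, uniquely by density. The statement on formal sums is then the universal
property of the direct sum. -/

theorem lintegral_sq_convolution_le {E : Type*} [NormedAddCommGroup E] [MeasurableSpace E]
    [BorelSpace E] [SecondCountableTopology E] (μ : Measure E) [SFinite μ] [μ.IsAddLeftInvariant]
    [μ.IsNegInvariant] {G B : E → ENNReal} (hG : Measurable G) (hB : Measurable B) :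
    ∫⁻ ξ, (∫⁻ t, G t * B (ξ - t) ∂μ) ^ 2 ∂μ ≤ (∫⁻ t, B t ∂μ) ^ 2 * ∫⁻ t, G t ^ 2 ∂μ := by
  have : μ.IsAddRightInvariant := by
    constructor
    intro g
    simpa [add_comm] using Measure.IsAddLeftInvariant.map_add_left_eq_self (μ := μ) g
  have h1 : ∀ ξ, (∫⁻ t, G t * B (ξ - t) ∂μ) ^ 2 ≤
      (∫⁻ t, B t ∂μ) * ∫⁻ t, G t ^ 2 * B (ξ - t) ∂μ := by
    intro ξ
    have hBm : Measurable fun t => B (ξ - t) := hB.comp (measurable_const.sub measurable_id)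
    -- Cauchy–Schwarz for `G B = B^(1/2) · (G B^(1/2))`: one factor gives the `L¹` norm of `B`, and
    -- the other is integrated over `ξ` by Tonelli. This is Young's inequality `L¹ * L² ⊆ L²`.
    have h := ENNReal.lintegral_mul_le_Lp_mul_Lq μ Real.HolderConjugate.two_two
      (f := fun t => B (ξ - t) ^ (1 / 2 : ℝ)) (g := fun t => G t * B (ξ - t) ^ (1 / 2 : ℝ))
      (hBm.pow_const _).aemeasurable (hG.mul (hBm.pow_const _)).aemeasurable
    have e1 : ∀ x : ENNReal, x ^ (1 / 2 : ℝ) * x ^ (1 / 2 : ℝ) = x := by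
      intro x
      rw [← ENNReal.rpow_add_of_nonneg _ _ (by norm_num) (by norm_num)]
      norm_num
    have e2 : ∀ x : ENNReal, (x ^ (1 / 2 : ℝ)) ^ (2 : ℝ) = x := by
      intro x
      rw [← ENNReal.rpow_mul]
      norm_num
    have e3 : (fun t => B (ξ - t) ^ (1 / 2 : ℝ)) * (fun t => G t * B (ξ - t) ^ (1 / 2 : ℝ)) =
        fun t => G t * B (ξ - t) := by
      ext t
      simp only [Pi.mul_apply]
      rw [mul_left_comm, e1]
    rw [e3] at h
    simp only [ENNReal.mul_rpow_of_nonneg _ _ (show (0 : ℝ) ≤ 2 by norm_num), e2] at h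
    calc _ ≤ _ := pow_le_pow_left' h 2
      _ = (∫⁻ t, B (ξ - t) ∂μ) * ∫⁻ t, G t ^ 2 * B (ξ - t) ∂μ := by
        rw [mul_pow, ← ENNReal.rpow_natCast, ← ENNReal.rpow_natCast, Nat.cast_ofNat, e2, e2]
        simp
      _ = _ := by rw [lintegral_sub_left_eq_self]
  calc _ ≤ ∫⁻ ξ, (∫⁻ t, B t ∂μ) * ∫⁻ t, G t ^ 2 * B (ξ - t) ∂μ ∂μ := lintegral_mono h1
    _ = (∫⁻ t, B t ∂μ) * ∫⁻ ξ, ∫⁻ t, G t ^ 2 * B (ξ - t) ∂μ ∂μ := by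
      rw [lintegral_const_mul]
      exact Measurable.lintegral_prod_right'
        (f := fun p : E × E => G p.2 ^ 2 * B (p.1 - p.2)) (by fun_prop)
    _ = (∫⁻ t, B t ∂μ) * ∫⁻ t, ∫⁻ ξ, G t ^ 2 * B (ξ - t) ∂μ ∂μ := by
      rw [lintegral_lintegral_swap]
      exact (show Measurable (fun p : E × E => G p.2 ^ 2 * B (p.1 - p.2)) by
        fun_prop).aemeasurable
    _ = _ := by
      have h2 : ∀ t, ∫⁻ ξ, G t ^ 2 * B (ξ - t) ∂μ = G t ^ 2 * ∫⁻ ξ, B ξ ∂μ := by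
        intro t
        rw [lintegral_const_mul _ (by fun_prop), lintegral_sub_right_eq_self]
      simp only [h2]
      rw [lintegral_mul_const _ (by fun_prop)]
      ring

/-- Peetre's inequality. -/
theorem one_add_norm_sq_rpow_le {E : Type*} [NormedAddCommGroup E] (σ : ℝ) (ξ η : E) :
    (1 + ‖ξ‖ ^ 2) ^ (σ / 2) ≤
      2 ^ (|σ| / 2) * ((1 + ‖η‖ ^ 2) ^ (σ / 2) * (1 + ‖ξ - η‖ ^ 2) ^ (|σ| / 2)) := by
  have key : ∀ a b : E, 1 + ‖a‖ ^ 2 ≤ 2 * ((1 + ‖b‖ ^ 2) * (1 + ‖a - b‖ ^ 2)) := by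
    intro a b
    have h : ‖a‖ ≤ ‖b‖ + ‖a - b‖ := by simpa using norm_add_le b (a - b)
    nlinarith [norm_nonneg a, norm_nonneg b, norm_nonneg (a - b), sq_nonneg (‖b‖ - ‖a - b‖),
      mul_nonneg (sq_nonneg ‖b‖) (sq_nonneg ‖a - b‖)]
  have pos : ∀ a : E, 0 < 1 + ‖a‖ ^ 2 := fun a => by positivity
  rcases le_total 0 σ with h | h
  · rw [abs_of_nonneg h, ← Real.mul_rpow (pos _).le (pos _).le,
      ← Real.mul_rpow (by norm_num) (mul_pos (pos _) (pos _)).le]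
    exact Real.rpow_le_rpow (pos _).le (key ξ η) (by linarith)
  -- For negative `σ` the inequality is that of order `|σ|` with `ξ` and `η` exchanged, read through
  -- inverses.
  · rw [abs_of_nonpos h]
    have e : ∀ a : E, (1 + ‖a‖ ^ 2) ^ (σ / 2) = ((1 + ‖a‖ ^ 2) ^ (-σ / 2))⁻¹ := by
      intro a
      rw [← Real.rpow_neg (pos a).le]
      ring_nf
    rw [e, e, mul_left_comm, ← div_eq_inv_mul, inv_le_iff_one_le_mul₀ (by have := pos ξ; positivity),
      div_mul_eq_mul_div, one_le_div (by have := pos η; positivity), mul_assoc,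
      ← Real.mul_rpow (pos _).le (pos _).le,
      ← Real.mul_rpow (by norm_num) (mul_pos (pos _) (pos _)).le]
    refine Real.rpow_le_rpow (pos _).le ?_ (by linarith)
    have := key η ξ
    rw [norm_sub_rev] at this
    linarith

theorem enorm_ofReal (x : ℝ) : ‖(x : ℂ)‖ₑ = ‖x‖ₑ := by
  rw [← ofReal_norm, Complex.norm_real, ofReal_norm]

theorem hasTemperateGrowth_sobolevWeight (d : ℕ) (σ : ℝ) :
    (fun ξ : Model d => (((1 + ‖ξ‖ ^ 2) ^ (σ / 2) : ℝ) : ℂ)).HasTemperateGrowth := by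
  fun_prop

/-- The square of the Sobolev norm, as an integral on the frequency side. -/
theorem enorm_bessel_sq {d r : ℕ} (σ : ℝ) (f : 𝓢(Model d, EuclideanSpace ℂ (Fin r))) :
    ‖bessel d r σ f‖ₑ ^ 2 = ∫⁻ ξ, (‖(1 + ‖ξ‖ ^ 2) ^ (σ / 2)‖ₑ * ‖𝓕 f ξ‖ₑ) ^ 2 := by
  set g := SchwartzMap.smulLeftCLM (EuclideanSpace ℂ (Fin r))
    (fun ξ : Model d => (((1 + ‖ξ‖ ^ 2) ^ (σ / 2) : ℝ) : ℂ)) (𝓕 f) with hg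
  have h1 : bessel d r σ f = (𝓕⁻ g).toLp 2 := rfl
  have h2 : ‖(𝓕⁻ g).toLp 2‖ = ‖g.toLp 2‖ := by
    rw [← SchwartzMap.norm_fourier_toL2_eq, FourierTransform.fourier_fourierInv_eq]
  have h3 : ‖(𝓕⁻ g).toLp 2‖ₑ = ‖g.toLp 2‖ₑ := by
    rw [← ofReal_norm, h2, ofReal_norm]
  rw [h1, h3, Lp.enorm_def, eLpNorm_congr_ae (g.coeFn_toLp 2 volume),
    eLpNorm_eq_lintegral_rpow_enorm_toReal (by norm_num) (by norm_num)]
  rw [← ENNReal.rpow_natCast, ← ENNReal.rpow_mul]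
  simp only [ENNReal.toReal_ofNat, Nat.cast_ofNat, one_div]
  rw [inv_mul_cancel₀ (by norm_num), ENNReal.rpow_one]
  refine lintegral_congr fun ξ => ?_
  rw [hg, SchwartzMap.smulLeftCLM_apply_apply (hasTemperateGrowth_sobolevWeight d σ), enorm_smul,
    enorm_ofReal, ENNReal.rpow_two]

/-- The convolution of Schwartz functions is the inverse transform of the product of their
transforms. Applied to `𝓕⁻ g` and `𝓕⁻ b` it gives `𝓕⁻ h`; reflecting both variables turns `𝓕⁻` into
`𝓕`. -/
theorem fourier_eq_integral_of_eq_smul {d r : ℕ} (g : 𝓢(Model d, ℂ))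
    (b h : 𝓢(Model d, EuclideanSpace ℂ (Fin r))) (hh : ∀ z, h z = g z • b z) (ξ : Model d) :
    𝓕 h ξ = ∫ t, 𝓕 g t • 𝓕 b (ξ - t) := by
  have e : ∀ {V : Type} [NormedAddCommGroup V] [NormedSpace ℂ V] (f : 𝓢(Model d, V))
      (z : Model d), 𝓕⁻ f z = 𝓕 f (-z) := fun f z => rfl
  have h1 : h = SchwartzMap.pairing (ContinuousLinearMap.lsmul ℂ ℂ) (𝓕 (𝓕⁻ g)) (𝓕 (𝓕⁻ b)) := by
    ext1 z
    simp [SchwartzMap.pairing_apply_apply, hh]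
  have h2 : 𝓕⁻ h = SchwartzMap.convolution (ContinuousLinearMap.lsmul ℂ ℂ) (𝓕⁻ g) (𝓕⁻ b) := by
    rw [h1]; rfl
  have h3 : 𝓕 h ξ = 𝓕⁻ h (-ξ) := by rw [e, neg_neg]
  rw [h3, h2, SchwartzMap.convolution_apply, MeasureTheory.convolution, ← integral_neg_eq_self]
  refine integral_congr_ae (Eventually.of_forall fun t => ?_)
  change 𝓕 g (- -t) • 𝓕 b (-(-ξ - -t)) = _
  congr 2
  · simp
  · abel_nf

/-- Multiplication by a vector valued Schwartz function is bounded on the Sobolev scale. -/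
theorem exists_lintegral_fourier_smul_le {d r : ℕ} (σ : ℝ)
    (b : 𝓢(Model d, EuclideanSpace ℂ (Fin r))) :
    ∃ C : ENNReal, C ≠ ⊤ ∧ ∀ (g : 𝓢(Model d, ℂ)) (h : 𝓢(Model d, EuclideanSpace ℂ (Fin r))),
      (∀ z, h z = g z • b z) →
      ‖bessel d r σ h‖ₑ ^ 2 ≤ C * ∫⁻ ξ, (‖(1 + ‖ξ‖ ^ 2) ^ (σ / 2)‖ₑ * ‖𝓕 g ξ‖ₑ) ^ 2 := by
  -- Peetre's inequality moves the weight of order `σ` onto `𝓕 g`, at the price of a weight of order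
  -- `|σ|` on `𝓕 b`. What remains is a convolution with `B`, which is integrable because `𝓕 b` is a
  -- Schwartz function.
  set B : Model d → ENNReal :=
    fun ξ => ‖(2 : ℝ) ^ (|σ| / 2)‖ₑ * (‖(1 + ‖ξ‖ ^ 2) ^ (|σ| / 2)‖ₑ * ‖𝓕 b ξ‖ₑ) with hBdef
  have hBm : Measurable B := by
    have : Measurable fun ξ : Model d => 𝓕 b ξ := (𝓕 b).continuous.measurable
    rw [hBdef]
    fun_prop
  have hBfin : ∫⁻ ξ, B ξ ≠ ⊤ := by
    have hi : Integrable (SchwartzMap.smulLeftCLM (EuclideanSpace ℂ (Fin r))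
        (fun ξ : Model d => (((1 + ‖ξ‖ ^ 2) ^ (|σ| / 2) : ℝ) : ℂ)) (𝓕 b)) :=
      SchwartzMap.integrable _
    rw [hBdef, lintegral_const_mul' _ _ (by simp)]
    refine ENNReal.mul_ne_top (by simp) ?_
    have := hi.2.ne
    convert this using 2
    ext ξ
    rw [SchwartzMap.smulLeftCLM_apply_apply (hasTemperateGrowth_sobolevWeight d _), enorm_smul,
      enorm_ofReal]
  refine ⟨(∫⁻ ξ, B ξ) ^ 2, ENNReal.pow_ne_top hBfin, fun g h hh => ?_⟩
  have hGm : Measurable fun ξ : Model d => ‖(1 + ‖ξ‖ ^ 2) ^ (σ / 2)‖ₑ * ‖𝓕 g ξ‖ₑ := by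
    have : Measurable fun ξ : Model d => 𝓕 g ξ := (𝓕 g).continuous.measurable
    fun_prop
  rw [enorm_bessel_sq]
  refine le_trans (lintegral_mono fun ξ => ?_) (lintegral_sq_convolution_le volume hGm hBm)
  refine pow_le_pow_left' ?_ 2
  rw [fourier_eq_integral_of_eq_smul g b h hh ξ]
  calc _ ≤ ‖(1 + ‖ξ‖ ^ 2) ^ (σ / 2)‖ₑ * ∫⁻ t, ‖𝓕 g t • 𝓕 b (ξ - t)‖ₑ :=
        mul_le_mul_right (enorm_integral_le_lintegral_enorm _) _
    _ = ∫⁻ t, ‖(1 + ‖ξ‖ ^ 2) ^ (σ / 2)‖ₑ * ‖𝓕 g t • 𝓕 b (ξ - t)‖ₑ := by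
        rw [lintegral_const_mul' _ _ (by simp)]
    _ ≤ _ := by
        refine lintegral_mono fun t => ?_
        have hp : ‖(1 + ‖ξ‖ ^ 2) ^ (σ / 2)‖ₑ ≤ ‖(2 : ℝ) ^ (|σ| / 2)‖ₑ *
            (‖(1 + ‖t‖ ^ 2) ^ (σ / 2)‖ₑ * ‖(1 + ‖ξ - t‖ ^ 2) ^ (|σ| / 2)‖ₑ) := by
          rw [← enorm_mul, ← enorm_mul, enorm_le_iff_norm_le, Real.norm_of_nonneg (by positivity),
            Real.norm_of_nonneg (by positivity)]
          exact one_add_norm_sq_rpow_le σ ξ t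
        rw [enorm_smul]
        calc _ ≤ _ := mul_le_mul_left hp _
          _ = _ := by rw [hBdef]; ring

theorem norm_fourier_iteratedLineDeriv_le {d : ℕ} {j : ℕ} {V : Type*} [NormedAddCommGroup V]
    [NormedSpace ℂ V] (w : Fin j → Model d) (f : 𝓢(Model d, V)) (ξ : Model d) :
    ‖𝓕 (LineDeriv.iteratedLineDerivOp w f) ξ‖ ≤
      (2 * Real.pi) ^ j * (∏ i, ‖w i‖) * ‖ξ‖ ^ j * ‖𝓕 f ξ‖ := by
  induction j with
  | zero => simp
  | succ j ih =>
    rw [LineDeriv.iteratedLineDerivOp_succ_left, SchwartzMap.fourier_lineDerivOp_eq,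
      smul_apply, SchwartzMap.smulLeftCLM_apply_apply (by fun_prop), norm_smul, norm_smul,
      Fin.prod_univ_succ]
    have h1 : ‖(2 * Real.pi * Complex.I : ℂ)‖ = 2 * Real.pi := by
      simp [abs_of_pos Real.pi_pos]
    have h2 : ‖(inner ℝ ξ (w 0) : ℝ)‖ ≤ ‖ξ‖ * ‖w 0‖ := norm_inner_le_norm _ _
    rw [h1]
    calc _ ≤ 2 * Real.pi * (‖ξ‖ * ‖w 0‖ * ((2 * Real.pi) ^ j * (∏ i, ‖Fin.tail w i‖) *
          ‖ξ‖ ^ j * ‖𝓕 f ξ‖)) := by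
          gcongr
          exact ih _
      _ = _ := by simp only [Fin.tail]; ring

/-- A differential operator of length `j` with Schwartz coefficients is bounded from the Sobolev
space of order `s` to the one of order `s - n`, when the weight of order `n` dominates `|ξ|^j`. -/
theorem exists_norm_bessel_coeff_smul_deriv_le {d r j : ℕ} (s n : ℝ)
    (hj : ∀ ξ : Model d, ‖ξ‖ ^ j ≤ (1 + ‖ξ‖ ^ 2) ^ (n / 2))
    (b : 𝓢(Model d, EuclideanSpace ℂ (Fin r))) (w : Fin j → Model d) (l : Fin r) :
    ∃ C : ℝ, ∀ f h : 𝓢(Model d, EuclideanSpace ℂ (Fin r)),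
      (∀ z, h z = (iteratedFDeriv ℝ j f z w) l • b z) →
      ‖bessel d r (s - n) h‖ ≤ C * ‖bessel d r s f‖ := by
  obtain ⟨C, hC, hb⟩ := exists_lintegral_fourier_smul_le (s - n) b
  set K : ENNReal := ‖(2 * Real.pi) ^ j * (∏ i, ‖w i‖)‖ₑ
  have hK : K ≠ ⊤ := enorm_ne_top
  -- `C` comes from multiplication by `b`, and `K` from the multiplier of the derivatives without
  -- its factor `|ξ|^j`, which is absorbed by the weight of order `n`. The root undoes the squares
  -- of the norms.
  refine ⟨(C * K ^ 2).toReal ^ (1 / 2 : ℝ), fun f h hh => ?_⟩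
  set g : 𝓢(Model d, ℂ) := SchwartzMap.postcompCLM (EuclideanSpace.proj (𝕜 := ℂ) l)
    (LineDeriv.iteratedLineDerivOp w f)
  have hg : ∀ ξ, 𝓕 g ξ = (𝓕 (LineDeriv.iteratedLineDerivOp w f) ξ) l := by
    intro ξ
    rw [SchwartzMap.fourier_coe, SchwartzMap.fourier_coe, Real.fourier_eq, Real.fourier_eq]
    refine Eq.trans ?_ ((EuclideanSpace.proj (𝕜 := ℂ) (ι := Fin r)
      l).integral_comp_comm ((Real.fourierIntegral_convergent_iff ξ).2
        (LineDeriv.iteratedLineDerivOp w f).integrable))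
    refine integral_congr_ae (Eventually.of_forall fun v => ?_)
    simp [g, Circle.smul_def]
  have h1 := hb g h (fun z => by
    rw [hh z, ← SchwartzMap.iteratedLineDerivOp_eq_iteratedFDeriv]; rfl)
  have h2 : ‖bessel d r (s - n) h‖ₑ ^ 2 ≤ C * K ^ 2 * ‖bessel d r s f‖ₑ ^ 2 := by
    refine h1.trans ?_
    rw [enorm_bessel_sq, mul_assoc]
    refine mul_le_mul_right ?_ _
    rw [← lintegral_const_mul' _ _ (ENNReal.pow_ne_top hK)]
    refine lintegral_mono fun ξ => ?_
    rw [← mul_pow]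
    refine pow_le_pow_left' ?_ 2
    simp only [K]
    rw [← enorm_norm (𝓕 g ξ), ← enorm_norm (𝓕 f ξ), ← enorm_mul, ← enorm_mul, ← enorm_mul,
      enorm_le_iff_norm_le, Real.norm_of_nonneg (by positivity),
      Real.norm_of_nonneg (by positivity)]
    have h3 : ‖𝓕 g ξ‖ ≤ (2 * Real.pi) ^ j * (∏ i, ‖w i‖) * ‖ξ‖ ^ j * ‖𝓕 f ξ‖ := by
      rw [hg]
      exact (PiLp.norm_apply_le _ _).trans (norm_fourier_iteratedLineDeriv_le w f ξ)
    have h4 : (1 + ‖ξ‖ ^ 2) ^ ((s - n) / 2) * (1 + ‖ξ‖ ^ 2) ^ (n / 2) =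
        (1 + ‖ξ‖ ^ 2) ^ (s / 2) := by
      rw [← Real.rpow_add (by positivity)]
      ring_nf
    rw [← h4]
    calc _ ≤ (1 + ‖ξ‖ ^ 2) ^ ((s - n) / 2) *
          ((2 * Real.pi) ^ j * (∏ i, ‖w i‖) * (1 + ‖ξ‖ ^ 2) ^ (n / 2) * ‖𝓕 f ξ‖) := by
          refine mul_le_mul_of_nonneg_left (h3.trans ?_) (by positivity)
          gcongr
          exact hj ξ
      _ = _ := by ring
  have h5 : ‖bessel d r (s - n) h‖ ^ 2 ≤ (C * K ^ 2).toReal * ‖bessel d r s f‖ ^ 2 := by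
    have := ENNReal.toReal_mono (by
      refine ENNReal.mul_ne_top (ENNReal.mul_ne_top hC (ENNReal.pow_ne_top hK)) (by simp)) h2
    simpa [ENNReal.toReal_mul] using this
  rw [← Real.sqrt_eq_rpow, ← Real.sqrt_sq (norm_nonneg (bessel d r s f)),
    ← Real.sqrt_mul (by positivity)]
  exact Real.le_sqrt_of_sq_le h5

/-! ### Pseudo-differential operators on functions which vanish to high order -/

section Scaling

variable {d : ℕ}

/-- Descending induction on the order: derivatives of order at least `m` are bounded by compact
support, and below `m` each derivative vanishes at `z₀`, so the mean value inequality on the segment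
from `z₀` gains one power of the distance. The truncated `m - j` covers `j ≥ m` as mere boundedness.
-/
theorem exists_norm_iteratedFDeriv_le_pow {F : Type*} [NormedAddCommGroup F] [NormedSpace ℝ F]
    {m : ℕ} {g : Model d → F} (hg : ContDiff ℝ ∞ g) (hc : HasCompactSupport g) {z₀ : Model d}
    (hv : ∀ j < m, iteratedFDeriv ℝ j g z₀ = 0) (j : ℕ) :
    ∃ C, 0 ≤ C ∧ ∀ z, ‖iteratedFDeriv ℝ j g z‖ ≤ C * ‖z - z₀‖ ^ (m - j) := by
  have hb : ∀ j, ∃ C, 0 ≤ C ∧ ∀ z, ‖iteratedFDeriv ℝ j g z‖ ≤ C := by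
    intro j
    obtain ⟨C, hC⟩ := (hc.iteratedFDeriv (𝕜 := ℝ) j).exists_bound_of_continuous
      (hg.continuous_iteratedFDeriv (mod_cast le_top))
    exact ⟨C, (norm_nonneg _).trans (hC z₀), hC⟩
  have key : ∀ k j, j + k = m →
      ∃ C, 0 ≤ C ∧ ∀ z, ‖iteratedFDeriv ℝ j g z‖ ≤ C * ‖z - z₀‖ ^ k := by
    intro k
    induction k with
    | zero => intro j _; simpa using hb j
    | succ k ih =>
      intro j hj
      obtain ⟨C, hC0, hC⟩ := ih (j + 1) (by omega)
      refine ⟨C, hC0, fun z => ?_⟩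
      have hd : Differentiable ℝ (iteratedFDeriv ℝ j g) :=
        hg.differentiable_iteratedFDeriv (mod_cast ENat.natCast_lt_top _)
      have h := (convex_segment z₀ z).norm_image_sub_le_of_norm_fderiv_le (𝕜 := ℝ)
        (f := iteratedFDeriv ℝ j g) (C := C * ‖z - z₀‖ ^ k) (fun x _ => hd x) (fun x hx => by
          rw [norm_fderiv_iteratedFDeriv]
          refine (hC x).trans ?_
          gcongr
          rw [norm_sub_rev x, norm_sub_rev z]
          have := segment_subset_closedBall_left z₀ z hx
          rwa [mem_closedBall_iff_norm', dist_eq_norm] at this)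
        (left_mem_segment ℝ z₀ z) (right_mem_segment ℝ z₀ z)
      rw [hv j (by omega), sub_zero] at h
      rw [pow_succ, ← mul_assoc]
      exact h
  rcases le_total j m with h | h
  · exact key (m - j) j (by omega)
  · simpa [Nat.sub_eq_zero_of_le h] using hb j

/-- A derivative of order `k` of `g (z₀ + ε y)` brings `ε^k` by the chain rule and `(ε |y|)^(m - k)`
by the vanishing of `g`. The powers of `|y|` are absorbed by the decay of `ρ`, which makes the
majorant `H` integrable and independent of `ε`. -/
theorem exists_norm_iteratedFDeriv_rescale_le {m : ℕ} {g : Model d → ℂ} (hg : ContDiff ℝ ∞ g)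
    (hc : HasCompactSupport g) {z₀ : Model d} (hv : ∀ j < m, iteratedFDeriv ℝ j g z₀ = 0)
    (ρ : 𝓢(Model d, ℝ)) (j : ℕ) :
    ∃ H : Model d → ℝ, Integrable H ∧ ∀ ε, 0 < ε → ε ≤ 1 → ∀ y,
      ‖iteratedFDeriv ℝ j (fun y => ρ y • g (z₀ + ε • y)) y‖ ≤ ε ^ m * H y := by
  choose C hC0 hC using fun i => exists_norm_iteratedFDeriv_le_pow hg hc hv i
  refine ⟨fun y => ∑ i ∈ Finset.range (j + 1), (j.choose i : ℝ) * ‖iteratedFDeriv ℝ i ρ y‖ *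
    (C (j - i) * ‖y‖ ^ (m - (j - i))), ?_, fun ε h0 h1 y => ?_⟩
  · refine integrable_finsetSum _ fun i _ => ?_
    have := (ρ.integrable_pow_mul_iteratedFDeriv volume (m - (j - i)) i).const_mul
      ((j.choose i : ℝ) * C (j - i))
    refine this.congr (Eventually.of_forall fun y => ?_)
    ring
  · have hgc : ContDiff ℝ ∞ fun y => g (z₀ + ε • y) := by fun_prop
    refine (norm_iteratedFDeriv_smul_le (N := ∞) (ρ.smooth ⊤) hgc y (mod_cast le_top)).trans ?_
    rw [Finset.mul_sum]
    refine Finset.sum_le_sum fun i _ => ?_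
    rw [mul_left_comm]
    refine mul_le_mul_of_nonneg_left ?_ (by positivity)
    set k := j - i
    have e : iteratedFDeriv ℝ k (fun y => g (z₀ + ε • y)) y =
        ε ^ k • iteratedFDeriv ℝ k g (z₀ + ε • y) := by
      have h1 := iteratedFDeriv_comp_const_smul (i := k) (f := fun z => g (z₀ + z)) ε
        ((hg.comp (contDiff_const.add contDiff_id)).of_le (mod_cast le_top))
      have h2 := congrFun h1 y
      simp only [iteratedFDeriv_comp_add_left] at h2
      exact h2
    rw [e, norm_smul, norm_pow, Real.norm_of_nonneg h0.le]
    calc _ ≤ ε ^ k * (C k * ‖(z₀ + ε • y) - z₀‖ ^ (m - k)) := by gcongr; exact hC k _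
      _ = ε ^ (k + (m - k)) * (C k * ‖y‖ ^ (m - k)) := by
        rw [add_sub_cancel_left, norm_smul, Real.norm_of_nonneg h0.le, mul_pow, pow_add]; ring
      _ ≤ _ := by
        refine mul_le_mul_of_nonneg_right ?_ (mul_nonneg (hC0 k) (by positivity))
        -- With truncated subtraction `k + (m - k)` is `max k m`, so this uses `ε ≤ 1`.
        exact pow_le_pow_of_le_one h0.le h1 (by omega)

/-- Smoothness becomes decay of the transform: `|ξ|^M` times the transform is controlled by
integrals of derivatives of order at most `M`, each of which carries the factor `ε^m`. The exponents
`0` and `M` together give the weight `(1 + |ξ|)^(-M)`. -/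
theorem exists_norm_fourier_rescale_le {m : ℕ} {g : Model d → ℂ} (hg : ContDiff ℝ ∞ g)
    (hc : HasCompactSupport g) {z₀ : Model d} (hv : ∀ j < m, iteratedFDeriv ℝ j g z₀ = 0)
    {ρ : Model d → ℝ} (hρ : ContDiff ℝ ∞ ρ) (hρc : HasCompactSupport ρ) (M : ℕ) :
    ∃ C, 0 ≤ C ∧ ∀ ε, 0 < ε → ε ≤ 1 → ∀ ξ,
      ‖𝓕 (fun y => ρ y • g (z₀ + ε • y)) ξ‖ ≤ C * ε ^ m * (1 + ‖ξ‖) ^ (-(M : ℝ)) := by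
  choose H hHi hH using fun j => exists_norm_iteratedFDeriv_rescale_le hg hc hv
    (hρc.toSchwartzMap hρ) j
  have hdec : ∀ M : ℕ, ∃ C, 0 ≤ C ∧ ∀ ε, 0 < ε → ε ≤ 1 → ∀ ξ,
      ‖ξ‖ ^ M * ‖𝓕 (fun y => ρ y • g (z₀ + ε • y)) ξ‖ ≤ C * ε ^ m := by
    intro M
    refine ⟨2 ^ M * ∑ p ∈ Finset.range (0 + 1) ×ˢ Finset.range (M + 1), |∫ y, H p.2 y|,
      by positivity, fun ε h0 h1 ξ => ?_⟩
    have hgc : ContDiff ℝ ∞ fun y => g (z₀ + ε • y) := by fun_prop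
    have hvs : ContDiff ℝ ∞ (fun y => ρ y • g (z₀ + ε • y)) := hρ.smul hgc
    have hvc : HasCompactSupport (fun y => ρ y • g (z₀ + ε • y)) := hρc.smul_right
    have hint : ∀ k n : ℕ, Integrable
        (fun y => ‖y‖ ^ k * ‖iteratedFDeriv ℝ n (fun y => ρ y • g (z₀ + ε • y)) y‖) := fun k n =>
      (hvc.toSchwartzMap hvs).integrable_pow_mul_iteratedFDeriv volume k n
    have h := Real.pow_mul_norm_iteratedFDeriv_fourier_le (K := ⊤) (N := ⊤) (k := 0) (n := M)
      hvs (fun k n _ _ => hint k n) (by simp) (by simp) ξ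
    simp only [norm_iteratedFDeriv_zero] at h
    refine h.trans ?_
    simp only [pow_zero, Nat.cast_zero, mul_zero, zero_add, one_mul]
    rw [mul_assoc, Finset.sum_mul]
    refine mul_le_mul_of_nonneg_left (Finset.sum_le_sum fun p hp => ?_) (by positivity)
    have hp1 : p.1 = 0 := by simpa using (Finset.mem_product.1 hp).1
    calc _ ≤ ∫ y, ε ^ m * H p.2 y := by
          refine integral_mono (hint _ _) ((hHi _).const_mul _) fun y => ?_
          simpa [hp1] using hH p.2 ε h0 h1 y
      _ ≤ _ := by
          rw [integral_const_mul, mul_comm]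
          gcongr
          exact le_abs_self _
  obtain ⟨A, hA0, hA⟩ := hdec 0
  obtain ⟨B, hB0, hB⟩ := hdec M
  refine ⟨2 ^ M * (A + B), by positivity, fun ε h0 h1 ξ => ?_⟩
  rw [Real.rpow_neg (by positivity), ← div_eq_mul_inv, le_div_iff₀ (by positivity),
    Real.rpow_natCast]
  have hA' := hA ε h0 h1 ξ
  have hB' := hB ε h0 h1 ξ
  rw [pow_zero, one_mul] at hA'
  have hp : (1 + ‖ξ‖) ^ M ≤ 2 ^ M * (1 + ‖ξ‖ ^ M) := by
    have h := add_pow_le (zero_le_one' ℝ) (norm_nonneg ξ) M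
    rw [one_pow] at h
    refine h.trans ?_
    gcongr
    · norm_num
    · omega
  calc _ ≤ ‖𝓕 (fun y => ρ y • g (z₀ + ε • y)) ξ‖ * (2 ^ M * (1 + ‖ξ‖ ^ M)) := by gcongr
    _ = 2 ^ M * (‖𝓕 (fun y => ρ y • g (z₀ + ε • y)) ξ‖ +
        ‖ξ‖ ^ M * ‖𝓕 (fun y => ρ y • g (z₀ + ε • y)) ξ‖) := by ring
    _ ≤ 2 ^ M * (A * ε ^ m + B * ε ^ m) := by gcongr
    _ = _ := by ring

theorem norm_fourier_comp_rescale (v : Model d → ℂ) (z₀ : Model d) {ε : ℝ} (hε : 0 < ε)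
    (ξ : Model d) :
    ‖𝓕 (fun z => v (ε⁻¹ • (z - z₀))) ξ‖ = ε ^ d * ‖𝓕 v (ε • ξ)‖ := by
  rw [Real.fourier_eq, Real.fourier_eq]
  have h1 : ∫ z, Real.fourierChar (-inner ℝ z ξ) • v (ε⁻¹ • (z - z₀)) =
      ∫ z, Real.fourierChar (-inner ℝ z₀ ξ) •
        (fun y => Real.fourierChar (-inner ℝ y (ε • ξ)) • v y) (ε⁻¹ • z) := by
    rw [← integral_add_right_eq_self _ z₀]
    refine integral_congr_ae (Eventually.of_forall fun z => ?_)
    simp only [add_sub_cancel_right, smul_smul]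
    rw [inner_add_left, real_inner_smul_left, real_inner_smul_right, inv_mul_cancel_left₀ hε.ne',
      neg_add, AddChar.map_add_eq_mul, mul_comm]
  simp only [Circle.smul_def (Real.fourierChar (-inner ℝ z₀ ξ))] at h1
  rw [h1, integral_smul, norm_smul, Circle.norm_coe, one_mul, Measure.integral_comp_inv_smul volume
    (fun y => Real.fourierChar (-inner ℝ y (ε • ξ)) • v y) ε, norm_smul]
  simp [abs_of_pos hε]

/-- For `x > 0` the expression is `ε^(m - n) (ε + x)^n`, and `m > n`. At `x = 0` only `ε^m` remains,
whence the alternative `0 < m ∨ 0 < x`. -/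
theorem tendsto_rescaled_weight {m : ℕ} {n : ℝ} (hnm : n < m) {x : ℝ} (hx : 0 ≤ x)
    (h : 0 < m ∨ 0 < x) :
    Tendsto (fun ε : ℝ => ε ^ m * (1 + ε⁻¹ * x) ^ n) (𝓝[>] 0) (𝓝 0) := by
  have hid : Tendsto (fun ε : ℝ => ε) (𝓝[>] 0) (𝓝 0) := tendsto_nhdsWithin_of_tendsto_nhds tendsto_id
  rcases hx.eq_or_lt with rfl | hx
  · have hm : m ≠ 0 := by rcases h with h | h <;> [exact h.ne'; exact absurd h (lt_irrefl _)]
    simpa [hm] using hid.pow m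
  · have h1 : Tendsto (fun ε : ℝ => ε ^ (m - n) * (ε + x) ^ n) (𝓝[>] 0) (𝓝 0) := by
      have ha : Tendsto (fun ε : ℝ => ε ^ (m - n)) (𝓝[>] 0) (𝓝 0) := by
        simpa [Real.zero_rpow (sub_pos.2 hnm).ne'] using
          hid.rpow_const (p := (m : ℝ) - n) (Or.inr (sub_pos.2 hnm).le)
      have hb : Tendsto (fun ε : ℝ => (ε + x) ^ n) (𝓝[>] 0) (𝓝 ((0 + x) ^ n)) :=
        (hid.add_const x).rpow_const (Or.inl (by simpa using hx.ne'))
      simpa using ha.mul hb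
    refine h1.congr' ?_
    filter_upwards [self_mem_nhdsWithin] with ε (hε : 0 < ε)
    have e : 1 + ε⁻¹ * x = ε⁻¹ * (ε + x) := by field_simp
    rw [e, Real.mul_rpow (by positivity) (by positivity), Real.inv_rpow hε.le,
      Real.rpow_sub hε, Real.rpow_natCast]
    field_simp

/-- A majorant uniform in `ε`, which allows dominated convergence along the limit of
`tendsto_rescaled_weight`. -/
theorem rescaled_weight_le {m : ℕ} {n : ℝ} (hnm : n < m) {x : ℝ} (hx : 0 ≤ x) {ε : ℝ}
    (h0 : 0 < ε) (h1 : ε ≤ 1) : ε ^ m * (1 + ε⁻¹ * x) ^ n ≤ (1 + x) ^ |n| := by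
  rcases le_total 0 n with hn | hn
  · have e : 1 + ε⁻¹ * x = ε⁻¹ * (ε + x) := by field_simp
    rw [abs_of_nonneg hn, e, Real.mul_rpow (by positivity) (by positivity), Real.inv_rpow h0.le,
      ← mul_assoc, ← Real.rpow_natCast, ← div_eq_mul_inv, ← Real.rpow_sub h0]
    have ha : ε ^ ((m : ℝ) - n) ≤ 1 := Real.rpow_le_one h0.le h1 (by linarith)
    have hb : (ε + x) ^ n ≤ (1 + x) ^ n := Real.rpow_le_rpow (by positivity) (by linarith) hn
    calc _ ≤ 1 * (1 + x) ^ n := by gcongr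
      _ = _ := one_mul _
  · have ha : ε ^ m ≤ 1 := pow_le_one₀ h0.le h1
    have hy : 0 ≤ ε⁻¹ * x := by positivity
    have hb : (1 + ε⁻¹ * x) ^ n ≤ 1 := Real.rpow_le_one_of_one_le_of_nonpos (by linarith) hn
    calc _ ≤ (1 : ℝ) * 1 := by gcongr
      _ ≤ _ := by rw [one_mul]; exact Real.one_le_rpow (by linarith) (abs_nonneg _)

/-- If `g` vanishes to order `m > n` at `z₀`, then an oscillatory integral with an amplitude of
order `n` applied to `g`, cut off to a ball of radius `ε` about `z₀`, tends to zero with `ε`. -/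
theorem tendsto_integral_fourier_cutoff {m : ℕ} {n : ℝ} (hnm : n < m) (hd : 0 < m ∨ 0 < d)
    {q e : Model d → ℂ} {c : ℝ} (hq : ∀ ξ, ‖q ξ‖ ≤ c * (1 + ‖ξ‖) ^ n) (he : ∀ ξ, ‖e ξ‖ = 1)
    {g : Model d → ℂ} (hg : ContDiff ℝ ∞ g) (hc : HasCompactSupport g) {z₀ : Model d}
    (hv : ∀ j < m, iteratedFDeriv ℝ j g z₀ = 0)
    {ρ : Model d → ℝ} (hρ : ContDiff ℝ ∞ ρ) (hρc : HasCompactSupport ρ) :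
    Tendsto (fun ε : ℝ => ∫ ξ, q ξ * 𝓕 (fun z => ρ (ε⁻¹ • (z - z₀)) • g z) ξ * e ξ)
      (𝓝[>] 0) (𝓝 0) := by
  -- Enough decay for `(1 + |ζ|)^(|n| - M)` to be integrable on `ℝ^d`.
  obtain ⟨M, hM⟩ := exists_nat_gt (|n| + d)
  obtain ⟨C, hC0, hC⟩ := exists_norm_fourier_rescale_le hg hc hv hρ hρc M
  have hc0 : 0 ≤ c := by simpa using (norm_nonneg _).trans (hq 0)
  -- `B ε` bounds the integrand after the substitution `ξ = ζ/ε`. The factor `ε^d` in the transform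
  -- of the rescaled cut-off cancels the Jacobian.
  set B : ℝ → Model d → ℝ := fun ε ζ =>
    c * C * ((ε ^ m * (1 + ε⁻¹ * ‖ζ‖) ^ n) * (1 + ‖ζ‖) ^ (-(M : ℝ))) with hB
  have hBm : ∀ ε, AEStronglyMeasurable (B ε) volume := fun ε => by
    refine Measurable.aestronglyMeasurable ?_
    rw [hB]
    fun_prop
  set D : Model d → ℝ := fun ζ => c * C * (1 + ‖ζ‖) ^ (-(M - |n|)) with hD
  have hDi : Integrable D := by
    refine (integrable_one_add_norm ?_).const_mul _
    simp only [finrank_euclideanSpace, Fintype.card_fin]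
    linarith
  have hBD : ∀ ε, 0 < ε → ε ≤ 1 → ∀ ζ, ‖B ε ζ‖ ≤ D ζ := by
    intro ε h0 h1 ζ
    rw [Real.norm_of_nonneg (by positivity)]
    simp only [hB, hD]
    refine mul_le_mul_of_nonneg_left ?_ (by positivity)
    rw [neg_sub, sub_eq_add_neg, Real.rpow_add (by positivity)]
    gcongr
    exact rescaled_weight_le hnm (norm_nonneg _) h0 h1
  have hev : ∀ᶠ ε : ℝ in 𝓝[>] 0, 0 < ε ∧ ε ≤ 1 := by
    filter_upwards [Ioc_mem_nhdsGT (zero_lt_one' ℝ)] with ε hε using hε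
  have hlim : Tendsto (fun ε => ∫ ζ, B ε ζ) (𝓝[>] 0) (𝓝 (∫ _ : Model d, (0 : ℝ))) := by
    refine tendsto_integral_filter_of_dominated_convergence D
      (Eventually.of_forall hBm) ?_ hDi ?_
    · filter_upwards [hev] with ε hε using Eventually.of_forall (hBD ε hε.1 hε.2)
    -- For `m = 0` the majorant does not tend to zero at `ζ = 0`, but this point is negligible when
    -- `d > 0`.
    · have hae : ∀ᵐ ζ : Model d, 0 < m ∨ 0 < ‖ζ‖ := by
        rcases hd with h | h
        · exact Eventually.of_forall fun _ => Or.inl h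
        · have : Nonempty (Fin d) := ⟨⟨0, h⟩⟩
          filter_upwards [compl_mem_ae_iff.2 (measure_singleton (μ := volume) (0 : Model d))]
            with ζ hζ using Or.inr (norm_pos_iff.2 hζ)
      filter_upwards [hae] with ζ hζ
      have := ((tendsto_rescaled_weight hnm (norm_nonneg ζ) hζ).mul_const
        ((1 + ‖ζ‖) ^ (-(M : ℝ)))).const_mul (c * C)
      simpa [hB] using this
  rw [integral_zero] at hlim
  refine squeeze_zero_norm' ?_ hlim
  filter_upwards [hev] with ε hε
  obtain ⟨h0, h1⟩ := hε
  have hBi : Integrable (B ε) := hDi.mono' (hBm ε) (Eventually.of_forall (hBD ε h0 h1))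
  have hsub := Measure.integral_comp_inv_smul (volume : Measure (Model d))
    (fun ξ => q ξ * 𝓕 (fun z => ρ (ε⁻¹ • (z - z₀)) • g z) ξ * e ξ) ε
  have hcut : (fun z => ρ (ε⁻¹ • (z - z₀)) • g z) =
      fun z => (fun y => ρ y • g (z₀ + ε • y)) (ε⁻¹ • (z - z₀)) := by
    ext z
    simp [smul_smul, mul_inv_cancel₀ h0.ne']
  have hεd : (0 : ℝ) < ε ^ d := by positivity
  have hle : ‖∫ ζ, (fun ξ => q ξ * 𝓕 (fun z => ρ (ε⁻¹ • (z - z₀)) • g z) ξ * e ξ) (ε⁻¹ • ζ)‖ ≤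
      ∫ ζ, ε ^ d * B ε ζ := by
    refine norm_integral_le_of_norm_le (hBi.const_mul _) (Eventually.of_forall fun ζ => ?_)
    have hF := norm_fourier_comp_rescale (fun y => ρ y • g (z₀ + ε • y)) z₀ h0 (ε⁻¹ • ζ)
    rw [← hcut, smul_smul, mul_inv_cancel₀ h0.ne', one_smul] at hF
    simp only [norm_mul, he, mul_one, hF]
    have hq' := hq (ε⁻¹ • ζ)
    rw [norm_smul, Real.norm_of_nonneg (inv_nonneg.2 h0.le)] at hq'
    calc _ ≤ (c * (1 + ε⁻¹ * ‖ζ‖) ^ n) * (ε ^ d * (C * ε ^ m * (1 + ‖ζ‖) ^ (-(M : ℝ)))) := by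
          gcongr
          exact hC ε h0 h1 ζ
      _ = _ := by simp only [hB]; ring
  rw [hsub, norm_smul, integral_const_mul, finrank_euclideanSpace, Fintype.card_fin,
    Real.norm_of_nonneg (abs_nonneg _), abs_of_pos hεd] at hle
  exact le_of_mul_le_mul_left hle hεd

end Scaling

/-! ### Taylor polynomials -/

section Taylor

variable {d r : ℕ}

theorem fourier_iteratedLineDeriv {j : ℕ} {V : Type*} [NormedAddCommGroup V]
    [NormedSpace ℂ V] (w : Fin j → Model d) (f : 𝓢(Model d, V)) (ξ : Model d) :
    𝓕 (LineDeriv.iteratedLineDerivOp w f) ξ =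
      (∏ i, (2 * Real.pi * Complex.I) * (inner ℝ ξ (w i) : ℝ) : ℂ) • 𝓕 f ξ := by
  induction j with
  | zero => simp
  | succ j ih =>
    rw [LineDeriv.iteratedLineDerivOp_succ_left, SchwartzMap.fourier_lineDerivOp_eq,
      smul_apply, SchwartzMap.smulLeftCLM_apply_apply (by fun_prop), ih,
      Fin.prod_univ_succ, ← Complex.coe_smul, smul_smul, smul_smul]
    rfl

/-- The iterated derivatives of a Schwartz function are symmetric. -/
theorem iteratedFDeriv_schwartz_comp_perm {j : ℕ} {V : Type*} [NormedAddCommGroup V]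
    [NormedSpace ℂ V] [CompleteSpace V] (f : 𝓢(Model d, V)) (z : Model d) (w : Fin j → Model d)
    (σ : Equiv.Perm (Fin j)) :
    iteratedFDeriv ℝ j f z (fun i => w (σ i)) = iteratedFDeriv ℝ j f z w := by
  rw [← SchwartzMap.iteratedLineDerivOp_eq_iteratedFDeriv,
    ← SchwartzMap.iteratedLineDerivOp_eq_iteratedFDeriv]
  -- After the Fourier transform the derivative is multiplication by a product of scalars, which
  -- does not see the order of the directions.
  have h : 𝓕 (LineDeriv.iteratedLineDerivOp (fun i => w (σ i)) f) =
      𝓕 (LineDeriv.iteratedLineDerivOp w f) := by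
    ext1 ξ
    rw [fourier_iteratedLineDeriv, fourier_iteratedLineDeriv,
      Equiv.prod_comp σ fun i => (2 * Real.pi * Complex.I) * (inner ℝ ξ (w i) : ℝ)]
  have h' := congrArg (fun g : 𝓢(Model d, V) => 𝓕⁻ g) h
  simp only [FourierTransform.fourierInv_fourier_eq] at h'
  rw [h']

theorem complexify_injective : Function.Injective (complexify r) := by
  intro w w' h
  ext k
  have := congrArg (fun v : EuclideanSpace ℂ (Fin r) => v k) h
  simpa [complexify] using this

theorem iteratedFDeriv_complexify_comp {u : Model d → Fib r} (hu : ContDiff ℝ ∞ u) (j : ℕ)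
    (z : Model d) (w : Fin j → Model d) :
    iteratedFDeriv ℝ j (fun z => complexify r (u z)) z w =
      complexify r (iteratedFDeriv ℝ j u z w) := by
  have := (complexify r).iteratedFDeriv_comp_left (f := u) (x := z) (i := j) (n := ∞)
    hu.contDiffAt (mod_cast le_top)
  change iteratedFDeriv ℝ j (⇑(complexify r) ∘ u) z w = _
  rw [this]
  rfl

theorem iteratedFDeriv_comp_perm_of_hasCompactSupport {u : Model d → Fib r}
    (hu : ContDiff ℝ ∞ u) (hc : HasCompactSupport u) {j : ℕ} (z : Model d) (w : Fin j → Model d)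
    (σ : Equiv.Perm (Fin j)) :
    iteratedFDeriv ℝ j u z (fun i => w (σ i)) = iteratedFDeriv ℝ j u z w := by
  apply complexify_injective
  have hcc : HasCompactSupport fun z => complexify r (u z) :=
    hc.comp_left (g := complexify r) (map_zero _)
  have := iteratedFDeriv_schwartz_comp_perm
    (hcc.toSchwartzMap ((complexify r).contDiff.comp hu)) z w σ
  rw [← iteratedFDeriv_complexify_comp hu, ← iteratedFDeriv_complexify_comp hu]
  exact this

/-- The Taylor polynomial at `z₀`, of degree less than `m`. -/
def taylorPoly (m : ℕ) (u : Model d → Fib r) (z₀ z : Model d) : Fib r :=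
  ∑ j ∈ Finset.range m, ((j.factorial : ℝ)⁻¹) • iteratedFDeriv ℝ j u z₀ fun _ => z - z₀

/-- The `j`-th derivative of a power series at its centre is the sum of its coefficient over all
permutations of the arguments. By symmetry the `j!` terms are equal and cancel the factorial. -/
theorem iteratedFDeriv_taylorPoly {m : ℕ} {u : Model d → Fib r}
    (hu : ContDiff ℝ ∞ u) (hc : HasCompactSupport u) (z₀ : Model d) {j : ℕ} (hj : j < m) :
    iteratedFDeriv ℝ j (taylorPoly m u z₀) z₀ = iteratedFDeriv ℝ j u z₀ := by
  set p : FormalMultilinearSeries ℝ (Model d) (Fib r) := fun j =>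
    if j < m then ((j.factorial : ℝ)⁻¹) • iteratedFDeriv ℝ j u z₀ else 0 with hp
  have h : HasFiniteFPowerSeriesOnBall (taylorPoly m u z₀) p z₀ m ⊤ := by
    refine .mk' (fun i hi => ?_) (by simp) fun y _ => ?_
    · simp only [hp, if_neg (not_lt.2 hi)]
    · refine Finset.sum_congr rfl fun i hi => ?_
      simp only [hp, if_pos (Finset.mem_range.1 hi), add_sub_cancel_left]
      rfl
  ext1 v
  rw [h.toHasFPowerSeriesOnBall.iteratedFDeriv_eq_sum_of_completeSpace]
  simp only [hp, if_pos hj]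
  have e : ∀ σ : Equiv.Perm (Fin j),
      (((j.factorial : ℝ)⁻¹) • iteratedFDeriv ℝ j u z₀) (fun i => v (σ i)) =
        ((j.factorial : ℝ)⁻¹) • iteratedFDeriv ℝ j u z₀ v := by
    intro σ
    rw [← iteratedFDeriv_comp_perm_of_hasCompactSupport hu hc z₀ v σ]
    rfl
  rw [Finset.sum_congr rfl fun σ _ => e σ, Finset.sum_const, Finset.card_univ, Fintype.card_perm,
    Fintype.card_fin, ← Nat.cast_smul_eq_nsmul ℝ, smul_smul,
    mul_inv_cancel₀ (mod_cast j.factorial_ne_zero), one_smul]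

/-- The index set of the terms of an expanded Taylor polynomial. -/
abbrev TaylorIndex (m d : ℕ) : Type := Σ j : Fin m, (Fin j → Fin d) × Finset (Fin j)

/-- The directions of differentiation of a term of the Taylor polynomial. -/
def TaylorIndex.dir {m : ℕ} (I : TaylorIndex m d) : Fin I.1 → Model d :=
  fun i => EuclideanSpace.single (I.2.1 i) 1

/-- The monomial in `z` of a term of the Taylor polynomial. -/
def TaylorIndex.monomial {m : ℕ} (I : TaylorIndex m d) (z : Model d) : ℝ :=
  ∏ i ∈ I.2.2, z (I.2.1 i)

/-- The coefficient, which depends on `z₀`, of a term of the Taylor polynomial. -/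
def TaylorIndex.coeff {m : ℕ} (I : TaylorIndex m d) (z₀ : Model d) : ℝ :=
  (((I.1 : ℕ).factorial : ℝ)⁻¹) * ∏ i ∈ Finset.univ \ I.2.2, -(z₀ (I.2.1 i))

theorem TaylorIndex.contDiff_monomial {m : ℕ} (I : TaylorIndex m d) :
    ContDiff ℝ ∞ I.monomial :=
  contDiff_prod fun i _ => (EuclideanSpace.proj (𝕜 := ℝ) (I.2.1 i)).contDiff

theorem TaylorIndex.contDiff_coeff {m : ℕ} (I : TaylorIndex m d) : ContDiff ℝ ∞ I.coeff :=
  contDiff_const.mul (contDiff_prod fun i _ =>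
    (EuclideanSpace.proj (𝕜 := ℝ) (I.2.1 i)).contDiff.neg)

theorem map_const_eq_sum {j : ℕ} {V : Type*} [NormedAddCommGroup V] [NormedSpace ℝ V]
    (L : Model d [×j]→L[ℝ] V) (z : Model d) :
    L (fun _ => z) = ∑ w : Fin j → Fin d, (∏ i, z (w i)) •
      L fun i => EuclideanSpace.single (w i) 1 := by
  have hz : z = ∑ k, z k • EuclideanSpace.single k (1 : ℝ) := by
    simpa using ((EuclideanSpace.basisFun (Fin d) ℝ).sum_repr z).symm
  conv_lhs => rw [hz]
  rw [L.map_sum (fun (_ : Fin j) k => z k • EuclideanSpace.single k (1 : ℝ))]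
  exact Finset.sum_congr rfl fun w _ => L.map_smul_univ _ _

/-- Expanding `∏ (z_(w i) - z₀_(w i))` over subsets of the factors separates the variables: an
operator can be applied to the monomials in `z`, while the functions of `z₀` come out by linearity
and stay smooth when `z₀` moves. -/
theorem taylorPoly_eq_sum (m : ℕ) (u : Model d → Fib r) (z₀ z : Model d) :
    taylorPoly m u z₀ z = ∑ I : TaylorIndex m d,
      (I.monomial z * I.coeff z₀) • iteratedFDeriv ℝ I.1 u z₀ I.dir := by
  rw [Fintype.sum_sigma, taylorPoly, Finset.sum_range]
  refine Finset.sum_congr rfl fun j _ => ?_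
  rw [map_const_eq_sum, Finset.smul_sum, Fintype.sum_prod_type]
  refine Finset.sum_congr rfl fun w _ => ?_
  change _ = ∑ S : Finset (Fin j), ((∏ i ∈ S, z (w i)) * (((j : ℕ).factorial : ℝ)⁻¹ *
    ∏ i ∈ Finset.univ \ S, -(z₀ (w i)))) • iteratedFDeriv ℝ j u z₀ fun i =>
      EuclideanSpace.single (w i) 1
  rw [← Finset.sum_smul, smul_smul]
  congr 1
  have e : ∀ i, (z - z₀) (w i) = z (w i) + -(z₀ (w i)) := fun i => sub_eq_add_neg _ _
  simp only [e]
  rw [Finset.prod_add, Finset.mul_sum, Finset.powerset_univ]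
  exact Finset.sum_congr rfl fun S _ => by ring

/-- If the weight of order `n` dominates `|ξ|^j` for all `j < m`, then the order of a differential
operator without terms of order at least `m` is at most `n`. -/
theorem exists_order (d : ℕ) (n : ℝ) : ∃ m : ℕ, n < m ∧ (0 < m ∨ 0 < d) ∧
    ∀ j < m, ∀ ξ : Model d, ‖ξ‖ ^ j ≤ (1 + ‖ξ‖ ^ 2) ^ (n / 2) := by
  rcases Nat.eq_zero_or_pos d with rfl | hd
  -- When `d = 0` all weights are `1`, so any order is harmless, but `m` has to be positive.
  · refine ⟨⌊n⌋₊ + 1, mod_cast Nat.lt_floor_add_one n, Or.inl (by omega), fun j _ ξ => ?_⟩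
    have : ξ = 0 := Subsingleton.elim _ _
    subst this
    simpa using pow_le_one₀ (le_refl (0 : ℝ)) zero_le_one
  · rcases lt_or_ge n 0 with hn | hn
    -- With `m = 0` no term is left: for `d > 0` a local operator of negative degree is zero.
    · exact ⟨0, mod_cast hn, Or.inr hd, fun j hj => absurd hj (Nat.not_lt_zero j)⟩
    · refine ⟨⌊n⌋₊ + 1, mod_cast Nat.lt_floor_add_one n, Or.inl (by omega), fun j hj ξ => ?_⟩
      have hjn : (j : ℝ) ≤ n := (Nat.le_floor_iff hn).1 (by omega)
      have h1 : (1 : ℝ) ≤ 1 + ‖ξ‖ ^ 2 := by nlinarith [sq_nonneg ‖ξ‖]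
      calc ‖ξ‖ ^ j = (‖ξ‖ ^ 2) ^ ((j : ℝ) / 2) := by
            rw [← Real.rpow_natCast, ← Real.rpow_natCast, ← Real.rpow_mul (norm_nonneg _)]
            congr 1
            push_cast
            ring
        _ ≤ (1 + ‖ξ‖ ^ 2) ^ ((j : ℝ) / 2) := by
            refine Real.rpow_le_rpow (by positivity) (by linarith) (by positivity)
        _ ≤ _ := Real.rpow_le_rpow_of_exponent_le h1 (by linarith)

end Taylor

/-! ### Sections in a chart of the base and a trivialization of the bundle -/

theorem contDiff_smul_of_tsupport_subset {E F : Type*} [NormedAddCommGroup E] [NormedSpace ℝ E]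
    [NormedAddCommGroup F] [NormedSpace ℝ F] {Ω : Set E} (hΩ : IsOpen Ω) {η : E → ℝ} {u : E → F}
    (hη : ContDiff ℝ ∞ η) (hs : tsupport η ⊆ Ω) (hu : ContDiffOn ℝ ∞ u Ω) :
    ContDiff ℝ ∞ fun z => η z • u z := by
  rw [contDiff_iff_contDiffAt]
  intro z
  by_cases hz : z ∈ tsupport η
  · exact hη.contDiffAt.smul (hu.contDiffAt (hΩ.mem_nhds (hs hz)))
  · have h0 : (fun z => η z • u z) =ᶠ[𝓝 z] fun _ => 0 := by
      filter_upwards [(isClosed_tsupport η).isOpen_compl.mem_nhds hz] with w hw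
      rw [image_eq_zero_of_notMem_tsupport hw, zero_smul]
    exact contDiffAt_const.congr_of_eventuallyEq h0

/-- If `g` vanishes to order `m` at `κ z`, then `L • (g ∘ κ)` vanishes to order `m` at `z`. -/
theorem iteratedFDeriv_clm_apply_comp_eq_zero {E E' F F' : Type*}
    [NormedAddCommGroup E] [NormedSpace ℝ E] [NormedAddCommGroup E'] [NormedSpace ℝ E']
    [NormedAddCommGroup F] [NormedSpace ℝ F] [NormedAddCommGroup F'] [NormedSpace ℝ F']
    {Ω : Set E} {Ω' : Set E'} (hΩ : IsOpen Ω) (hΩ' : IsOpen Ω') {κ : E → E'} {g : E' → F}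
    {L : E → F →L[ℝ] F'} (hκ : ContDiffOn ℝ ∞ κ Ω) (hg : ContDiffOn ℝ ∞ g Ω')
    (hL : ContDiffOn ℝ ∞ L Ω) (hmaps : MapsTo κ Ω Ω') {z : E} (hz : z ∈ Ω) {m : ℕ}
    (hv : ∀ j < m, iteratedFDeriv ℝ j g (κ z) = 0) {j : ℕ} (hj : j < m) :
    iteratedFDeriv ℝ j (fun y => L y (g (κ y))) z = 0 := by
  have hcomp : ∀ i < m, iteratedFDerivWithin ℝ i (g ∘ κ) Ω z = 0 := by
    intro i hi
    -- In the bound for the derivatives of a composite, the constant for `g` is `0`. `D` only has to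
    -- dominate the derivatives of `κ`, and the summand `1` gives `D ≤ D ^ l`.
    set D : ℝ := 1 + ∑ l ∈ Finset.range (i + 1), ‖iteratedFDerivWithin ℝ l κ Ω z‖ with hD
    have hD1 : 1 ≤ D := le_add_of_nonneg_right (Finset.sum_nonneg fun _ _ => norm_nonneg _)
    have h := norm_iteratedFDerivWithin_comp_le (n := i) (C := 0) (D := D) hg hκ
      (mod_cast le_top) hΩ'.uniqueDiffOn hΩ.uniqueDiffOn hmaps hz
      (fun l hl => by
        rw [iteratedFDerivWithin_of_isOpen l hΩ' (hmaps hz), hv l (by omega), norm_zero])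
      (fun l h1 hl => by
        calc _ ≤ ∑ l ∈ Finset.range (i + 1), ‖iteratedFDerivWithin ℝ l κ Ω z‖ :=
              Finset.single_le_sum (f := fun l => ‖iteratedFDerivWithin ℝ l κ Ω z‖)
                (fun _ _ => norm_nonneg _) (Finset.mem_range.2 (by omega))
          _ ≤ D := by rw [hD]; linarith
          _ ≤ D ^ l := le_self_pow₀ hD1 (by omega))
    simpa using h
  rw [← iteratedFDerivWithin_of_isOpen j hΩ hz]
  have h := norm_iteratedFDerivWithin_clm_apply (n := j) hL (hg.comp hκ hmaps) hΩ.uniqueDiffOn hz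
    (mod_cast le_top)
  rw [Finset.sum_eq_zero fun i _ => by rw [hcomp (j - i) (by omega), norm_zero, mul_zero]] at h
  simpa using h

section Charts

variable {d r : ℕ} {M : Type u} [TopologicalSpace M] [ChartedSpace (Model d) M]

/-- A smooth chart of the base together with a local trivialization of the bundle `A`. -/
structure BundleChart (A : VBundle d r M) where
  φ : OpenPartialHomeomorph M (Model d)
  φ_mem : φ ∈ IsManifold.maximalAtlas (𝓡 d) ∞ M
  t : Trivialization (Fib r) (TotalSpace.proj : A.Total → M)
  t_mem : t ∈ trivializationAtlas (Fib r) A.Fiber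

namespace BundleChart

variable {A : VBundle d r M} (c : BundleChart A)

instance : MemTrivializationAtlas c.t := ⟨c.t_mem⟩

/-- The subset of the model space where the chart and the trivialization are both defined. -/
def domain : Set (Model d) := c.φ.target ∩ c.φ.symm ⁻¹' c.t.baseSet

theorem isOpen_domain : IsOpen c.domain :=
  c.φ.symm.isOpen_inter_preimage c.t.open_baseSet

theorem map_mem_domain {x : M} (h1 : x ∈ c.φ.source) (h2 : x ∈ c.t.baseSet) :
    c.φ x ∈ c.domain :=
  ⟨c.φ.map_source h1, by simpa [c.φ.left_inv h1] using h2⟩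

/-- A section read in the chart and the trivialization. -/
def read (s : A.Sections) (z : Model d) : Fib r := (c.t ⟨c.φ.symm z, s (c.φ.symm z)⟩).2

theorem read_map (s : A.Sections) {x : M} (hx : x ∈ c.φ.source) :
    c.read s (c.φ x) = (c.t ⟨x, s x⟩).2 :=
  congrArg (fun y => (c.t ⟨y, s y⟩).2) (c.φ.left_inv hx)

theorem contDiffOn_symm_comp {V : Type*} [NormedAddCommGroup V] [NormedSpace ℝ V] {f : M → V}
    {Ω : Set (Model d)} (hΩ : Ω ⊆ c.φ.target)
    (hf : ∀ z ∈ Ω, ContMDiffAt (𝓡 d) 𝓘(ℝ, V) ∞ f (c.φ.symm z)) :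
    ContDiffOn ℝ ∞ (fun z => f (c.φ.symm z)) Ω := by
  intro z hz
  have h1 : ContMDiffAt (𝓡 d) (𝓡 d) ∞ c.φ.symm z :=
    contMDiffAt_symm_of_mem_maximalAtlas c.φ_mem (hΩ hz)
  have h2 : ContMDiffAt (𝓡 d) 𝓘(ℝ, V) ∞ (fun z => f (c.φ.symm z)) z := (hf z hz).comp z h1
  exact h2.contDiffAt.contDiffWithinAt

theorem contDiffOn_read (s : A.Sections) : ContDiffOn ℝ ∞ (c.read s) c.domain :=
  c.contDiffOn_symm_comp (f := fun x => (c.t ⟨x, s x⟩).2) inter_subset_left fun _ hz =>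
    (c.t.contMDiffAt_section_iff hz.2).1 s.contMDiff.contMDiffAt

theorem read_sum {ι : Type*} (I : Finset ι) (a : ι → ℝ) (s : ι → A.Sections) {z : Model d}
    (hz : z ∈ c.domain) : c.read (∑ i ∈ I, a i • s i) z = ∑ i ∈ I, a i • c.read (s i) z := by
  have hl := c.t.linear ℝ hz.2
  have e : ∀ s : A.Sections, c.read s z = (c.t.linearEquivAt ℝ _ hz.2) (s (c.φ.symm z)) :=
    fun _ => rfl
  simp only [e]
  rw [← ContMDiffSection.coeAddHom_apply, map_sum, Finset.sum_apply, map_sum]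
  refine Finset.sum_congr rfl fun i _ => ?_
  rw [ContMDiffSection.coeAddHom_apply, ContMDiffSection.coe_smul, Pi.smul_apply, map_smul]

theorem read_sub (s s' : A.Sections) {z : Model d} (hz : z ∈ c.domain) :
    c.read (s - s') z = c.read s z - c.read s' z := by
  have e : ∀ s : A.Sections, c.read s z = (c.t.linearEquivAt ℝ _ hz.2) (s (c.φ.symm z)) :=
    fun _ => rfl
  simp only [e]
  rw [ContMDiffSection.coe_sub, Pi.sub_apply, map_sub]

theorem eq_of_read_eq {s s' : A.Sections} {x : M} (h1 : x ∈ c.φ.source) (h2 : x ∈ c.t.baseSet)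
    (h : c.read s (c.φ x) = c.read s' (c.φ x)) : s x = s' x := by
  rw [c.read_map s h1, c.read_map s' h1] at h
  exact (c.t.linearEquivAt ℝ x h2).injective h

theorem eventuallyEq_of_read {s s' : A.Sections} {x : M} (h1 : x ∈ c.φ.source)
    (h2 : x ∈ c.t.baseSet) (h : c.read s =ᶠ[𝓝 (c.φ x)] c.read s') : ∀ᶠ y in 𝓝 x, s y = s' y := by
  filter_upwards [(c.φ.continuousAt h1).eventually h, c.φ.open_source.mem_nhds h1,
    c.t.open_baseSet.mem_nhds h2] with y hy hy1 hy2
  exact c.eq_of_read_eq hy1 hy2 hy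

theorem coordinates_eq (s : A.Sections) {z : Model d} (hz : z ∈ c.domain) :
    coordinates A c.φ c.t s z = complexify r (c.read s z) := by
  rw [coordinates, if_pos ⟨hz.1, hz.2⟩]
  rfl

theorem coordinates_eq_zero (s : A.Sections) {z : Model d} (hz : z ∉ c.domain) :
    coordinates A c.φ c.t s z = 0 := by
  rw [coordinates, if_neg fun h => hz ⟨h.1, h.2⟩]

theorem isCompact_symm_image {K : Set (Model d)} (hK : IsCompact K) (hs : K ⊆ c.domain) :
    IsCompact (c.φ.symm '' K) :=
  hK.image_of_continuousOn (c.φ.symm.continuousOn.mono fun _ hz => (hs hz).1)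

open Classical in
/-- Extension by zero of a function on the model space, transported to the manifold. -/
theorem contMDiff_extend [T2Space M] [IsManifold (𝓡 d) ∞ M] {η : Model d → ℝ}
    (hη : ContDiff ℝ ∞ η) (hc : HasCompactSupport η) (hs : tsupport η ⊆ c.domain) :
    ContMDiff (𝓡 d) 𝓘(ℝ, ℝ) ∞ fun x => if x ∈ c.φ.source then η (c.φ x) else 0 := by
  intro x
  by_cases hx : x ∈ c.φ.symm '' tsupport η
  · obtain ⟨z, hz, rfl⟩ := hx
    have hsrc : c.φ.symm z ∈ c.φ.source := c.φ.map_target (hs hz).1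
    have h : ContMDiffAt (𝓡 d) 𝓘(ℝ, ℝ) ∞ (fun x => η (c.φ x)) (c.φ.symm z) :=
      hη.contMDiff.contMDiffAt.comp _ (contMDiffAt_of_mem_maximalAtlas c.φ_mem hsrc)
    refine h.congr_of_eventuallyEq ?_
    filter_upwards [c.φ.open_source.mem_nhds hsrc] with y hy
    rw [if_pos hy]
  · refine (contMDiffAt_const (c := (0 : ℝ))).congr_of_eventuallyEq ?_
    filter_upwards [(c.isCompact_symm_image hc hs).isClosed.isOpen_compl.mem_nhds hx] with y hy
    split_ifs with h
    · by_contra h0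
      exact hy ⟨c.φ y, subset_tsupport _ h0, c.φ.left_inv h⟩
    · rfl

open Classical in
/-- The section with compact support in the common domain of the chart and the trivialization
which is given there by a function on the model space. -/
def extend [T2Space M] (u : Model d → Fib r) (hu : ContDiff ℝ ∞ u) (hc : HasCompactSupport u)
    (hs : tsupport u ⊆ c.domain) : A.Sections where
  toFun x := if x ∈ c.φ.source ∩ c.t.baseSet then c.t.symm x (u (c.φ x)) else 0
  contMDiff_toFun := by
    intro x
    by_cases hx : x ∈ c.φ.symm '' tsupport u
    · obtain ⟨z, hz, rfl⟩ := hx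
      have hsrc : c.φ.symm z ∈ c.φ.source := c.φ.map_target (hs hz).1
      have hbase : c.φ.symm z ∈ c.t.baseSet := (hs hz).2
      rw [c.t.contMDiffAt_section_iff hbase]
      have h : ContMDiffAt (𝓡 d) 𝓘(ℝ, Fib r) ∞ (fun x => u (c.φ x)) (c.φ.symm z) :=
        hu.contMDiff.contMDiffAt.comp _ (contMDiffAt_of_mem_maximalAtlas c.φ_mem hsrc)
      refine h.congr_of_eventuallyEq ?_
      filter_upwards [c.φ.open_source.mem_nhds hsrc, c.t.open_baseSet.mem_nhds hbase]
        with y hy hy'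
      rw [if_pos ⟨hy, hy'⟩, c.t.apply_mk_symm hy']
    · refine (contMDiffAt_zeroSection ℝ A.Fiber).congr_of_eventuallyEq ?_
      filter_upwards [(c.isCompact_symm_image hc hs).isClosed.isOpen_compl.mem_nhds hx] with y hy
      change (⟨y, _⟩ : A.Total) = ⟨y, 0⟩
      congr 1
      split_ifs with h
      · have h0 : u (c.φ y) = 0 := by
          by_contra h0
          exact hy ⟨c.φ y, subset_tsupport _ h0, c.φ.left_inv h.1⟩
        rw [h0, ← c.t.coe_symmₗ (R := ℝ) h.2, map_zero]
      · rfl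

variable {c}

open Classical in
theorem read_extend [T2Space M] {u : Model d → Fib r} (hu : ContDiff ℝ ∞ u)
    (hc : HasCompactSupport u) (hs : tsupport u ⊆ c.domain) {z : Model d} (hz : z ∈ c.domain) :
    c.read (c.extend u hu hc hs) z = u z := by
  have h : c.φ.symm z ∈ c.φ.source ∩ c.t.baseSet := ⟨c.φ.map_target hz.1, hz.2⟩
  change (c.t ⟨c.φ.symm z, if _ then _ else _⟩).2 = _
  rw [if_pos h, c.t.apply_mk_symm h.2, c.φ.right_inv hz.1]

theorem coordinates_extend [T2Space M] {u : Model d → Fib r} (hu : ContDiff ℝ ∞ u)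
    (hc : HasCompactSupport u) (hs : tsupport u ⊆ c.domain) (z : Model d) :
    coordinates A c.φ c.t (c.extend u hu hc hs) z = complexify r (u z) := by
  by_cases hz : z ∈ c.domain
  · rw [c.coordinates_eq _ hz, read_extend hu hc hs hz]
  · rw [c.coordinates_eq_zero _ hz, image_eq_zero_of_notMem_tsupport fun h => hz (hs h), map_zero]

open Classical in
theorem extend_eq_zero [T2Space M] {u : Model d → Fib r} (hu : ContDiff ℝ ∞ u)
    (hc : HasCompactSupport u) (hs : tsupport u ⊆ c.domain) {x : M}
    (hx : x ∉ c.φ.symm '' tsupport u) : c.extend u hu hc hs x = 0 := by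
  change (if _ then _ else _) = _
  split_ifs with h
  · have h0 : u (c.φ x) = 0 := by
      by_contra h0
      exact hx ⟨c.φ x, subset_tsupport _ h0, c.φ.left_inv h.1⟩
    rw [h0, ← c.t.coe_symmₗ (R := ℝ) h.2, map_zero]
  · rfl

/-- Vanishing of a section to a given order does not depend on the chart. -/
theorem iteratedFDeriv_read_eq_zero (c c' : BundleChart A) (s : A.Sections) {x : M}
    (h1 : x ∈ c.φ.source) (h2 : x ∈ c.t.baseSet) (h1' : x ∈ c'.φ.source) (h2' : x ∈ c'.t.baseSet)
    {m : ℕ} (hv : ∀ j < m, iteratedFDeriv ℝ j (c.read s) (c.φ x) = 0) {j : ℕ} (hj : j < m) :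
    iteratedFDeriv ℝ j (c'.read s) (c'.φ x) = 0 := by
  -- On `Ω` the reading in `c'` is the reading in `c` composed with the change of charts `κ`,
  -- followed by the linear change of fibre coordinates `L`.
  set Ω : Set (Model d) := c'.φ.target ∩
    c'.φ.symm ⁻¹' (c.φ.source ∩ (c.t.baseSet ∩ c'.t.baseSet)) with hΩdef
  have hΩ : IsOpen Ω := c'.φ.symm.isOpen_inter_preimage
    (c.φ.open_source.inter (c.t.open_baseSet.inter c'.t.open_baseSet))
  have hx : c'.φ x ∈ Ω := ⟨c'.φ.map_source h1', by
    simpa only [mem_preimage, c'.φ.left_inv h1'] using ⟨h1, h2, h2'⟩⟩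
  have hκ : ContDiffOn ℝ ∞ (fun z => c.φ (c'.φ.symm z)) Ω :=
    c'.contDiffOn_symm_comp inter_subset_left fun z hz =>
      contMDiffAt_of_mem_maximalAtlas c.φ_mem hz.2.1
  have hL : ContDiffOn ℝ ∞
      (fun z => (c.t.coordChangeL ℝ c'.t (c'.φ.symm z) : Fib r →L[ℝ] Fib r)) Ω :=
    c'.contDiffOn_symm_comp (f := fun y => (c.t.coordChangeL ℝ c'.t y : Fib r →L[ℝ] Fib r))
      inter_subset_left fun z hz => contMDiffAt_coordChangeL hz.2.2.1 hz.2.2.2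
  have hmaps : MapsTo (fun z => c.φ (c'.φ.symm z)) Ω c.domain := fun z hz =>
    c.map_mem_domain hz.2.1 hz.2.2.1
  have h := iteratedFDeriv_clm_apply_comp_eq_zero hΩ c.isOpen_domain hκ (c.contDiffOn_read s) hL
    hmaps hx (m := m) (by simpa only [c'.φ.left_inv h1'] using hv) hj
  rw [← h]
  refine (Filter.EventuallyEq.iteratedFDeriv ℝ ?_ j).eq_of_nhds
  filter_upwards [hΩ.mem_nhds hx] with z hz
  have e := c.t.coordChangeL_apply (R := ℝ) c'.t ⟨hz.2.2.1, hz.2.2.2⟩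
    (c.read s (c.φ (c'.φ.symm z)))
  rw [ContinuousLinearEquiv.coe_coe, e]
  rw [c.read_map s hz.2.1, c.t.symm_apply_apply_mk hz.2.2.1]
  rfl

end BundleChart

end Charts

/-! ### Local pseudo-differential operators -/

section LocalOperators

variable {d r : ℕ} {M : Type u} [TopologicalSpace M] [ChartedSpace (Model d) M]
  {A : VBundle d r M}

/-- An operator on sections is local if the germ of `P s` at a point depends only on the germ
of `s`. -/
def IsLocalOperator (P : A.Sections →ₗ[ℝ] A.Sections) : Prop :=
  ∀ (s s' : A.Sections) (x : M), (∀ᶠ y in 𝓝 x, s y = s' y) → P s x = P s' x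

theorem BundleChart.read_zero (c : BundleChart A) {z : Model d} (hz : z ∈ c.domain) :
    c.read 0 z = 0 := by
  simpa using c.read_sum (∅ : Finset ℕ) 0 0 hz

theorem IsSymbol.exists_norm_le {m : ℝ} {Ω : Set (Model d)} {p : Model d → Model d → ℂ}
    (h : IsSymbol m Ω p) {z : Model d} (hz : z ∈ Ω) :
    ∃ c, ∀ ξ, ‖p z ξ‖ ≤ c * (1 + ‖ξ‖) ^ m := by
  obtain ⟨c, hc⟩ := h.2 {z} isCompact_singleton (singleton_subset_iff.2 hz) 0 0
  refine ⟨c, fun ξ => ?_⟩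
  have := hc z rfl ξ
  rw [norm_iteratedFDeriv_zero, norm_iteratedFDeriv_zero] at this
  simpa using this

theorem complexify_apply (w : Fib r) (k : Fin r) : complexify r w k = ((w k : ℝ) : ℂ) := rfl

theorem tendsto_sum_integral_fourier_cutoff {m : ℕ} {n : ℝ} (hnm : n < m) (hd : 0 < m ∨ 0 < d)
    {q : Fin r → Model d → ℂ} (hq : ∀ l, ∃ b, ∀ ξ, ‖q l ξ‖ ≤ b * (1 + ‖ξ‖) ^ n)
    {g : Model d → Fib r} (hg : ContDiff ℝ ∞ g) (hgc : HasCompactSupport g) {z₀ : Model d}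
    (hgv : ∀ j < m, iteratedFDeriv ℝ j g z₀ = 0)
    {ρ : Model d → ℝ} (hρ : ContDiff ℝ ∞ ρ) (hρc : HasCompactSupport ρ) :
    Tendsto (fun ε : ℝ => ∑ l : Fin r, ∫ ξ : Model d,
        q l ξ * 𝓕 (fun z => ρ (ε⁻¹ • (z - z₀)) • ((g z l : ℝ) : ℂ)) ξ *
          Complex.exp (2 * Real.pi * Complex.I * (inner ℝ z₀ ξ : ℝ))) (𝓝[>] 0) (𝓝 0) := by
  have h0 : ∑ _ : Fin r, (0 : ℂ) = 0 := Finset.sum_const_zero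
  rw [← h0]
  refine tendsto_finsetSum _ fun l _ => ?_
  obtain ⟨b, hb⟩ := hq l
  set L : Fib r →L[ℝ] ℂ :=
    Complex.ofRealCLM.comp (EuclideanSpace.proj (𝕜 := ℝ) (ι := Fin r) l) with hL
  refine tendsto_integral_fourier_cutoff hnm hd hb (fun ξ => ?_) (g := fun z => L (g z))
    (L.contDiff.comp hg) (hgc.comp_left (map_zero L)) (fun j hj => ?_) hρ hρc
  · rw [Complex.norm_exp]
    simp
  · have e := L.iteratedFDeriv_comp_left (f := g) (x := z₀) (i := j) (n := ∞)
      hg.contDiffAt (mod_cast le_top)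
    change iteratedFDeriv ℝ j (L ∘ g) z₀ = 0
    rw [e, hgv j hj]
    ext v
    simp

set_option maxHeartbeats 400000 in
/-- A local pseudo-differential operator of degree `n < m` kills, at a point, the sections which
vanish there to order `m`. -/
theorem IsPseudoDiff.apply_eq_zero [T2Space M] [IsManifold (𝓡 d) ∞ M] {n : ℝ}
    {P : A.Sections →ₗ[ℝ] A.Sections} (hP : IsPseudoDiff n A P) (hloc : IsLocalOperator P)
    {m : ℕ} (hnm : n < m) (hd : 0 < m ∨ 0 < d) (c : BundleChart A) {x : M}
    (hx1 : x ∈ c.φ.source) (hx2 : x ∈ c.t.baseSet) (s : A.Sections)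
    (hv : ∀ j < m, iteratedFDeriv ℝ j (c.read s) (c.φ x) = 0) : P s x = 0 := by
  obtain ⟨φ, hφ, t, ht, W, hWo, hxW, hWs, p, hp, hform⟩ := hP x
  let c' : BundleChart A := ⟨φ, hφ, t, ht⟩
  have hxs : x ∈ c'.φ.source := (hWs hxW).1
  have hxb : x ∈ c'.t.baseSet := (hWs hxW).2
  set z₀ := c'.φ x with hz₀
  have hΩo : IsOpen (c'.φ '' W) :=
    c'.φ.isOpen_image_of_subset_source hWo fun _ hy => (hWs hy).1
  have hΩd : c'.φ '' W ⊆ c'.domain := by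
    rintro _ ⟨y, hy, rfl⟩
    exact c'.map_mem_domain (hWs hy).1 (hWs hy).2
  -- All cut-offs at scales `ε ≤ 1` are supported in this ball, hence over `W`, where the integral
  -- formula is valid.
  obtain ⟨R, hR0, hR⟩ := Metric.nhds_basis_closedBall.mem_iff.1
    (hΩo.mem_nhds (mem_image_of_mem c'.φ hxW))
  have hv' : ∀ j < m, iteratedFDeriv ℝ j (c'.read s) z₀ = 0 := fun j hj =>
    BundleChart.iteratedFDeriv_read_eq_zero c c' s hx1 hx2 hxs hxb hv hj
  let ρ : ContDiffBump (0 : Model d) := ⟨R / 2, R, by positivity, by linarith⟩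
  have hρ : ContDiff ℝ ∞ ρ := ρ.contDiff
  -- the cut-off at scale `ε`
  have hcut : ∀ ε : ℝ, ContDiff ℝ ∞ fun z => ρ (ε⁻¹ • (z - z₀)) := fun ε => by fun_prop
  have hcutsupp : ∀ ε : ℝ, 0 < ε → ε ≤ 1 →
      tsupport (fun z => ρ (ε⁻¹ • (z - z₀))) ⊆ Metric.closedBall z₀ R := by
    intro ε h0 h1
    refine closure_minimal (fun z hz => ?_) Metric.isClosed_closedBall
    have : ε⁻¹ • (z - z₀) ∈ Metric.ball (0 : Model d) R := by
      have h := ρ.support_eq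
      rw [← h]
      exact hz
    rw [mem_ball_zero_iff, norm_smul, Real.norm_of_nonneg (inv_nonneg.2 h0.le),
      inv_mul_lt_iff₀ h0] at this
    rw [mem_closedBall_iff_norm]
    nlinarith
  have hcutone : ∀ ε : ℝ, 0 < ε → ∀ᶠ z in 𝓝 z₀, ρ (ε⁻¹ • (z - z₀)) = 1 := by
    intro ε h0
    have hcont : Tendsto (fun z => ε⁻¹ • (z - z₀)) (𝓝 z₀) (𝓝 0) := by
      have : Continuous fun z => ε⁻¹ • (z - z₀) := by fun_prop
      simpa using this.tendsto z₀
    exact hcont.eventually ρ.eventuallyEq_one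
  set g : Model d → Fib r := fun z => ρ ((1 : ℝ)⁻¹ • (z - z₀)) • c'.read s z with hgdef
  have hsub1 : tsupport (fun z => ρ ((1 : ℝ)⁻¹ • (z - z₀))) ⊆ c'.domain :=
    (hcutsupp 1 one_pos le_rfl).trans (hR.trans hΩd)
  have hg : ContDiff ℝ ∞ g :=
    contDiff_smul_of_tsupport_subset c'.isOpen_domain (hcut 1) hsub1 (c'.contDiffOn_read s)
  have hgc : HasCompactSupport g :=
    (HasCompactSupport.of_support_subset_isCompact (isCompact_closedBall z₀ R)
      ((subset_tsupport _).trans (hcutsupp 1 one_pos le_rfl))).smul_right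
  have hgv : ∀ j < m, iteratedFDeriv ℝ j g z₀ = 0 := by
    intro j hj
    rw [← hv' j hj]
    refine (Filter.EventuallyEq.iteratedFDeriv ℝ ?_ j).eq_of_nhds
    filter_upwards [hcutone 1 one_pos] with z hz
    rw [hgdef]
    simp only [hz, one_smul]
  have hgread : g =ᶠ[𝓝 z₀] c'.read s := by
    filter_upwards [hcutone 1 one_pos] with z hz
    rw [hgdef]
    simp only [hz, one_smul]
  have key : ∀ k, coordinates A φ t (P s) z₀ k = 0 := by
    intro k
    have hlim := tendsto_sum_integral_fourier_cutoff hnm hd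
      (fun l => (hp k l).1.exists_norm_le (mem_image_of_mem φ hxW)) hg hgc hgv hρ
      ρ.hasCompactSupport
    -- By locality the value of `P s` at `x` equals the integral formula for the cut-off section at
    -- every scale `ε`. It is a constant family with limit zero.
    refine tendsto_nhds_unique (tendsto_const_nhds.congr' ?_) hlim
    filter_upwards [Ioc_mem_nhdsGT (zero_lt_one' ℝ)] with ε hε
    have hu : ContDiff ℝ ∞ fun z => ρ (ε⁻¹ • (z - z₀)) • g z := (hcut ε).smul hg
    have husupp : tsupport (fun z => ρ (ε⁻¹ • (z - z₀)) • g z) ⊆ Metric.closedBall z₀ R :=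
      (tsupport_smul_subset_left (fun z => ρ (ε⁻¹ • (z - z₀))) g).trans (hcutsupp ε hε.1 hε.2)
    have hucs : HasCompactSupport fun z => ρ (ε⁻¹ • (z - z₀)) • g z :=
      HasCompactSupport.of_support_subset_isCompact (isCompact_closedBall z₀ R)
        ((subset_tsupport _).trans husupp)
    have hudom := husupp.trans (hR.trans hΩd)
    have hsupp : ∃ K : Set M, IsCompact K ∧ K ⊆ W ∧
        ∀ y ∉ K, c'.extend _ hu hucs hudom y = 0 :=
      ⟨c'.φ.symm '' Metric.closedBall z₀ R,
        c'.isCompact_symm_image (isCompact_closedBall _ _) (hR.trans hΩd), by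
          rintro _ ⟨z, hz, rfl⟩
          obtain ⟨y, hy, rfl⟩ := hR hz
          rwa [c'.φ.left_inv (hWs hy).1],
        fun y hy => BundleChart.extend_eq_zero hu hucs hudom
          fun h => hy (image_mono husupp h)⟩
    have hsecs := hform (c'.extend _ hu hucs hudom) hsupp x hxW k
    have hPeq : P s x = P (c'.extend _ hu hucs hudom) x := by
      refine hloc _ _ x (c'.eventuallyEq_of_read hxs hxb ?_)
      filter_upwards [hgread, hcutone ε hε.1,
        c'.isOpen_domain.mem_nhds (c'.map_mem_domain hxs hxb)] with z h1 h2 h3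
      rw [BundleChart.read_extend hu hucs hudom h3, h2, one_smul, h1]
    have hcoord : coordinates A φ t (P s) z₀ k =
        coordinates A φ t (P (c'.extend _ hu hucs hudom)) (φ x) k := by
      have hdom := c'.map_mem_domain hxs hxb
      change coordinates A c'.φ c'.t _ (c'.φ x) k = coordinates A c'.φ c'.t _ (c'.φ x) k
      rw [c'.coordinates_eq _ hdom, c'.coordinates_eq _ hdom, c'.read_map _ hxs,
        c'.read_map _ hxs, hPeq]
    rw [hcoord, hsecs]
    refine Finset.sum_congr rfl fun l _ => ?_
    have hfun : (fun z => coordinates A φ t (c'.extend _ hu hucs hudom) z l) =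
        fun z => ρ (ε⁻¹ • (z - z₀)) • ((g z l : ℝ) : ℂ) := by
      ext z
      change coordinates A c'.φ c'.t (c'.extend _ hu hucs hudom) z l = _
      rw [BundleChart.coordinates_extend hu hucs hudom, complexify_apply]
      simp
    rw [hfun]
  have h0 : c'.read (P s) z₀ = 0 := by
    apply complexify_injective
    rw [map_zero, ← c'.coordinates_eq _ (c'.map_mem_domain hxs hxb)]
    ext k
    exact key k
  have h0' : c'.read (0 : A.Sections) z₀ = 0 := c'.read_zero (c'.map_mem_domain hxs hxb)
  exact c'.eq_of_read_eq hxs hxb (h0.trans h0'.symm)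

end LocalOperators

/-! ### Local pseudo-differential operators on Sobolev spaces -/

theorem exists_contDiff_one_nhds {d : ℕ} {K Ω : Set (Model d)} (hK : IsCompact K)
    (hΩ : IsOpen Ω) (hs : K ⊆ Ω) :
    ∃ η : Model d → ℝ, ContDiff ℝ ∞ η ∧ HasCompactSupport η ∧ tsupport η ⊆ Ω ∧
      ∀ z ∈ K, ∀ᶠ y in 𝓝 z, η y = 1 := by
  obtain ⟨L, hL, hKL, hLΩ⟩ := exists_compact_between hK hΩ hs
  obtain ⟨f, h1, h0, -⟩ := exists_contMDiffMap_one_nhds_of_subset_interior (n := ⊤) (𝓡 d)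
    hK.isClosed hKL
  have hsupp : Function.support f ⊆ L := fun z hz => by
    by_contra h
    exact hz (h0 z h)
  exact ⟨f, f.contMDiff.contDiff, HasCompactSupport.of_support_subset_isCompact hL hsupp,
    (closure_minimal hsupp hL.isClosed).trans hLΩ,
    fun z hz => h1.filter_mono (nhds_le_nhdsSet hz)⟩

section LocalOperators

variable {d r : ℕ} {M : Type u} [TopologicalSpace M] [ChartedSpace (Model d) M]
  {A : VBundle d r M}

/-- The chart and the trivialization of a localization. -/
def Localization.bundleChart (a : Localization A) : BundleChart A := ⟨a.φ, a.φ_mem, a.t, a.t_mem⟩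

theorem Localization.image_tsupport_subset (a : Localization A) :
    a.φ '' tsupport a.χ ⊆ a.bundleChart.domain := by
  rintro _ ⟨y, hy, rfl⟩
  exact a.bundleChart.map_mem_domain (a.tsupport_subset hy).1 (a.tsupport_subset hy).2

theorem Localization.toFun_eq_of_eq (a : Localization A) {s s' : A.Sections} {z : Model d}
    (h : s (a.φ.symm z) = s' (a.φ.symm z)) : a.toFun s z = a.toFun s' z := by
  simp only [Localization.toFun, coordinates, h]

open Classical in
/-- A cut-off function on the model space gives a localization. -/
def BundleChart.localization [T2Space M] [IsManifold (𝓡 d) ∞ M] (c : BundleChart A)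
    (η : Model d → ℝ) (hη : ContDiff ℝ ∞ η) (hc : HasCompactSupport η)
    (hs : tsupport η ⊆ c.domain) : Localization A where
  φ := c.φ
  φ_mem := c.φ_mem
  t := c.t
  t_mem := c.t_mem
  χ x := if x ∈ c.φ.source then η (c.φ x) else 0
  smooth := c.contMDiff_extend hη hc hs
  hasCompactSupport := HasCompactSupport.of_support_subset_isCompact
    (c.isCompact_symm_image hc hs) fun x hx => by
      have h : x ∈ c.φ.source := by
        by_contra h
        exact hx (if_neg h)
      refine ⟨c.φ x, subset_tsupport _ fun h0 => hx ?_, c.φ.left_inv h⟩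
      simp only [h0, ite_self]
  tsupport_subset := by
    have hsub : Function.support (fun x => if x ∈ c.φ.source then η (c.φ x) else 0) ⊆
        c.φ.symm '' tsupport η := fun x hx => by
      have h : x ∈ c.φ.source := by
        by_contra h
        exact hx (if_neg h)
      refine ⟨c.φ x, subset_tsupport _ fun h0 => hx ?_, c.φ.left_inv h⟩
      simp only [h0, ite_self]
    refine (closure_minimal hsub (c.isCompact_symm_image hc hs).isClosed).trans ?_
    rintro _ ⟨z, hz, rfl⟩
    exact ⟨c.φ.map_target (hs hz).1, (hs hz).2⟩

open Classical in
theorem BundleChart.localization_toFun [T2Space M] [IsManifold (𝓡 d) ∞ M] (c : BundleChart A)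
    {η : Model d → ℝ} (hη : ContDiff ℝ ∞ η) (hc : HasCompactSupport η)
    (hs : tsupport η ⊆ c.domain) (s : A.Sections) (z : Model d) :
    (c.localization η hη hc hs).toFun s z = complexify r (η z • c.read s z) := by
  change (if c.φ.symm z ∈ c.φ.source then η (c.φ (c.φ.symm z)) else 0) •
    coordinates A c.φ c.t s z = _
  by_cases hz : z ∈ c.domain
  · rw [if_pos (c.φ.map_target hz.1), c.φ.right_inv hz.1, c.coordinates_eq _ hz, map_smul]
  · rw [c.coordinates_eq_zero _ hz, smul_zero,
      image_eq_zero_of_notMem_tsupport fun h => hz (hs h), zero_smul, map_zero]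

/-- In a chart a local pseudo-differential operator is a differential operator with smooth
coefficients, of order at most its degree. -/
theorem IsPseudoDiff.exists_eq_sum_deriv [T2Space M] [IsManifold (𝓡 d) ∞ M] {n : ℝ}
    {P : A.Sections →ₗ[ℝ] A.Sections} (hP : IsPseudoDiff n A P) (hloc : IsLocalOperator P)
    {m : ℕ} (hnm : n < m) (hd : 0 < m ∨ 0 < d) (a : Localization A) :
    ∃ (a' : Localization A)
      (b : TaylorIndex m d → Fin r → 𝓢(Model d, EuclideanSpace ℂ (Fin r))),
      ∀ (s : A.Sections) (z : Model d), a.toSchwartz (P s) z =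
        ∑ I, ∑ l, (iteratedFDeriv ℝ I.1 (a'.toSchwartz s) z I.dir) l • b I l z := by
  set c := a.bundleChart with hcdef
  obtain ⟨η, hη, hηc, hηs, hη1⟩ :=
    exists_contDiff_one_nhds a.isCompact_image c.isOpen_domain a.image_tsupport_subset
  -- the sections given by the monomials
  let q : TaylorIndex m d → Fin r → Model d → Fib r := fun I l z =>
    η z • (I.monomial z • EuclideanSpace.single l (1 : ℝ))
  have hq : ∀ I l, ContDiff ℝ ∞ (q I l) := fun I l =>
    hη.smul (I.contDiff_monomial.smul contDiff_const)
  have hqs : ∀ I l, tsupport (q I l) ⊆ tsupport η := fun I l =>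
    tsupport_smul_subset_left η fun z => I.monomial z • EuclideanSpace.single l (1 : ℝ)
  have hqc : ∀ I l, HasCompactSupport (q I l) := fun I l =>
    HasCompactSupport.of_support_subset_isCompact hηc ((subset_tsupport _).trans (hqs I l))
  let σ : TaylorIndex m d → Fin r → A.Sections := fun I l =>
    c.extend (q I l) (hq I l) (hqc I l) ((hqs I l).trans hηs)
  have hbs : ∀ I l, ContDiff ℝ ∞ fun z => I.coeff z • a.toFun (P (σ I l)) z := fun I l =>
    I.contDiff_coeff.smul (a.contDiff_toFun _)
  have hbc : ∀ I l, HasCompactSupport fun z => I.coeff z • a.toFun (P (σ I l)) z := fun I l =>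
    (a.hasCompactSupport_toFun (P (σ I l))).smul_left (f := TaylorIndex.coeff I)
  -- The new localization keeps the chart and the trivialization and replaces `χ` by `η`, which is
  -- `1` near its support. The coefficient at `z` is `χ P` of a cut-off monomial, times the function
  -- of the centre `z₀` evaluated at `z₀ = z`.
  refine ⟨c.localization η hη hηc hηs, fun I l => (hbc I l).toSchwartzMap (hbs I l),
    fun s z => ?_⟩
  change a.toFun (P s) z = ∑ I : TaylorIndex m d, ∑ l,
    (iteratedFDeriv ℝ I.1 ((c.localization η hη hηc hηs).toFun s) z I.dir) l •
      (I.coeff z • a.toFun (P (σ I l)) z)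
  by_cases hz : z ∈ a.φ '' tsupport a.χ
  swap
  · simp only [a.toFun_eq_zero _ z hz, smul_zero, Finset.sum_const_zero]
  have hzd : z ∈ c.domain := a.image_tsupport_subset hz
  have hx1 : c.φ.symm z ∈ c.φ.source := c.φ.map_target hzd.1
  have hzx : c.φ (c.φ.symm z) = z := c.φ.right_inv hzd.1
  set u : Model d → Fib r := fun y => η y • c.read s y with hu
  have hus : ContDiff ℝ ∞ u :=
    contDiff_smul_of_tsupport_subset c.isOpen_domain hη hηs (c.contDiffOn_read s)
  have huc : HasCompactSupport u := hηc.smul_right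
  have hloc' : (c.localization η hη hηc hηs).toFun s = fun y => complexify r (u y) :=
    funext fun y => c.localization_toFun hη hηc hηs s y
  let D : TaylorIndex m d → Fin r → ℝ := fun I l => iteratedFDeriv ℝ I.1 u z I.dir l
  -- the section with the same Taylor polynomial
  let s' : A.Sections := ∑ I, ∑ l, (I.coeff z * D I l) • σ I l
  have hs' : s' = ∑ p : TaylorIndex m d × Fin r, (p.1.coeff z * D p.1 p.2) • σ p.1 p.2 := by
    rw [Fintype.sum_prod_type]
  have hread : ∀ᶠ y in 𝓝 z, c.read (s - s') y = (u - taylorPoly m u z) y := by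
    filter_upwards [hη1 z hz, c.isOpen_domain.mem_nhds hzd] with y hy hyd
    rw [c.read_sub _ _ hyd, hs', c.read_sum _ _ _ hyd, Pi.sub_apply, taylorPoly_eq_sum,
      Fintype.sum_prod_type]
    congr 1
    · simp only [hu, hy, one_smul]
    · refine Finset.sum_congr rfl fun I _ => ?_
      have e := (EuclideanSpace.basisFun (Fin r) ℝ).sum_repr (iteratedFDeriv ℝ I.1 u z I.dir)
      conv_rhs => rw [← e]
      rw [Finset.smul_sum]
      refine Finset.sum_congr rfl fun l _ => ?_
      rw [BundleChart.read_extend (hq I l) (hqc I l) ((hqs I l).trans hηs) hyd]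
      simp only [q, hy, smul_smul, D, EuclideanSpace.basisFun_repr,
        EuclideanSpace.basisFun_apply]
      congr 1
      ring
  -- `s - s'` vanishes to order `m` at this one point, so `P s` and `P s'` have the same value
  -- there.
  have hPeq : P (s - s') (c.φ.symm z) = 0 := by
    refine hP.apply_eq_zero hloc hnm hd c hx1 hzd.2 _ fun j hj => ?_
    rw [hzx, (Filter.EventuallyEq.iteratedFDeriv ℝ hread j).eq_of_nhds]
    have hT : ContDiff ℝ ∞ (taylorPoly m u z) := by
      have : taylorPoly m u z = fun y => ∑ I : TaylorIndex m d,
          (I.monomial y * I.coeff z) • iteratedFDeriv ℝ I.1 u z I.dir :=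
        funext fun y => taylorPoly_eq_sum m u z y
      rw [this]
      exact ContDiff.sum fun I _ => (I.contDiff_monomial.mul contDiff_const).smul contDiff_const
    rw [iteratedFDeriv_sub_apply (hus.contDiffAt.of_le (mod_cast le_top))
      (hT.contDiffAt.of_le (mod_cast le_top)), iteratedFDeriv_taylorPoly hus huc z hj, sub_self]
  have h1 : a.toFun (P s) z = a.toSchwartz (P s') z := by
    refine a.toFun_eq_of_eq ?_
    rw [map_sub, ContMDiffSection.coe_sub, Pi.sub_apply, sub_eq_zero] at hPeq
    exact hPeq
  rw [h1]
  simp only [s', map_sum, map_smul, sum_apply, smul_apply]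
  refine Finset.sum_congr rfl fun I _ => Finset.sum_congr rfl fun l _ => ?_
  rw [hloc', iteratedFDeriv_complexify_comp hus, complexify_apply]
  change _ • a.toFun (P (σ I l)) z = _
  rw [mul_comm, mul_smul, Complex.coe_smul]

/-- A local pseudo-differential operator of degree `n` is bounded from the Sobolev space of order
`s` to the one of order `s - n`. -/
theorem IsPseudoDiff.exists_norm_bessel_le [T2Space M] [IsManifold (𝓡 d) ∞ M] {n : ℝ}
    {P : A.Sections →ₗ[ℝ] A.Sections} (hP : IsPseudoDiff n A P) (hloc : IsLocalOperator P)
    (σ : ℝ) (a : Localization A) :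
    ∃ (a' : Localization A) (C : ℝ), ∀ s : A.Sections,
      ‖bessel d r (σ - n) (a.toSchwartz (P s))‖ ≤ C * ‖bessel d r σ (a'.toSchwartz s)‖ := by
  -- `m` is large enough for `P` to kill sections vanishing to order `m`, and small enough for the
  -- derivatives of order below `m` to cost at most `n` in the Sobolev scale.
  obtain ⟨m, hnm, hd, hm⟩ := exists_order d n
  obtain ⟨a', b, hb⟩ := hP.exists_eq_sum_deriv hloc hnm hd a
  have hC := fun (I : TaylorIndex m d) (l : Fin r) =>
    exists_norm_bessel_coeff_smul_deriv_le σ n (hm I.1 I.1.2) (b I l) I.dir l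
  choose C hC using hC
  refine ⟨a', ∑ I, ∑ l, C I l, fun s => ?_⟩
  set f := a'.toSchwartz s
  let h : TaylorIndex m d → Fin r → 𝓢(Model d, EuclideanSpace ℂ (Fin r)) := fun I l =>
    SchwartzMap.pairing (ContinuousLinearMap.lsmul ℂ ℂ)
      (SchwartzMap.postcompCLM (EuclideanSpace.proj (𝕜 := ℂ) (ι := Fin r) l)
        (LineDeriv.iteratedLineDerivOp I.dir f)) (b I l)
  have hh : ∀ I l z, h I l z = (iteratedFDeriv ℝ I.1 f z I.dir) l • b I l z := by
    intro I l z
    rw [← SchwartzMap.iteratedLineDerivOp_eq_iteratedFDeriv]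
    simp [h, SchwartzMap.pairing_apply_apply]
  have hsum : a.toSchwartz (P s) = ∑ I, ∑ l, h I l := by
    ext1 z
    simp only [sum_apply, hh]
    exact hb s z
  rw [hsum]
  simp only [map_sum]
  refine (norm_sum_le _ _).trans ?_
  rw [Finset.sum_mul]
  refine Finset.sum_le_sum fun I _ => (norm_sum_le _ _).trans ?_
  rw [Finset.sum_mul]
  exact Finset.sum_le_sum fun l _ => hC I l f (h I l) (hh I l)

end LocalOperators

/-! ### Operators on a gerbe -/

section Restriction

variable {d r : ℕ} {N : Type u} [TopologicalSpace N] [ChartedSpace (Model d) N]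
  {U V : Opens N}

theorem contMDiffAt_clm_of_apply {M : Type*} [TopologicalSpace M] [ChartedSpace (Model d) M]
    {L : M → Fib r →L[ℝ] Fib r} {x : M}
    (h : ∀ v, ContMDiffAt (𝓡 d) 𝓘(ℝ, Fib r) ∞ (fun y => L y v) x) :
    ContMDiffAt (𝓡 d) 𝓘(ℝ, Fib r →L[ℝ] Fib r) ∞ L x := by
  let b := EuclideanSpace.basisFun (Fin r) ℝ
  have hL : L = fun y => ∑ l, (EuclideanSpace.proj (𝕜 := ℝ) l).smulRight (L y (b l)) := by
    funext y
    ext1 v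
    conv_lhs => rw [← b.sum_repr v]
    simp [b]
  rw [hL]
  refine ContMDiffAt.sum fun l _ => ?_
  exact ((ContinuousLinearMap.smulRightL ℝ (Fib r) (Fib r)
    (EuclideanSpace.proj (𝕜 := ℝ) l)).contDiff.contMDiff.contMDiffAt).comp x (h (b l))

/-- A section over `U` restricts to `V ⊆ U`. -/
theorem RestrictionIso.exists_restrict [IsManifold (𝓡 d) ∞ N] {h : V ≤ U} {B : VBundle d r V}
    {A : VBundle d r U} (R : RestrictionIso h B A) (s : A.Sections) :
    ∃ t : B.Sections, ∀ x : V, R.app x (t x) = s ⟨x.1, h x.2⟩ := by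
  let i : V → U := Opens.inclusion h
  have hi : ContMDiff (𝓡 d) (𝓡 d) ∞ i := contMDiff_inclusion h
  refine ⟨⟨fun x => (R.app x).symm (s (i x)), fun x => ?_⟩, fun x => (R.app x).apply_symm_apply _⟩
  set tB := trivializationAt (Fib r) B.Fiber x with htB
  set tA := trivializationAt (Fib r) A.Fiber (i x) with htA
  have hxB : x ∈ tB.baseSet := mem_baseSet_trivializationAt _ _ x
  have hxA : i x ∈ tA.baseSet := mem_baseSet_trivializationAt _ _ (i x)
  -- Only the map from `B` to `A` is assumed smooth. `L` is its matrix in local trivializations; it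
  -- is smooth because its columns are, and then so is its inverse. `e` is the same matrix as an
  -- equivalence, where both trivializations are defined.
  let L : V → Fib r →L[ℝ] Fib r := fun y =>
    (tA.continuousLinearMapAt ℝ (i y)).comp
      (((R.app y : B.Fiber y →L[ℝ] A.Fiber (i y))).comp (tB.symmL ℝ y))
  let e : ∀ y (hB : y ∈ tB.baseSet) (hA : i y ∈ tA.baseSet), Fib r ≃L[ℝ] Fib r := fun y hB hA =>
    ((tB.continuousLinearEquivAt ℝ y hB).symm.trans (R.app y)).trans
      (tA.continuousLinearEquivAt ℝ (i y) hA)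
  have heL : ∀ y hB hA, (e y hB hA : Fib r →L[ℝ] Fib r) = L y := by
    intro y hB hA
    ext1 v
    change tA.continuousLinearEquivAt ℝ (i y) hA
      (R.app y ((tB.continuousLinearEquivAt ℝ y hB).symm v)) = _
    rw [tA.coe_continuousLinearEquivAt_eq hA, tB.symm_continuousLinearEquivAt_eq hB]
    rfl
  have hev : ∀ᶠ y in 𝓝 x, y ∈ tB.baseSet ∧ i y ∈ tA.baseSet :=
    Filter.Eventually.and (tB.open_baseSet.mem_nhds hxB)
      (hi.continuous.continuousAt.eventually (tA.open_baseSet.mem_nhds hxA))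
  have hL : ContMDiffAt (𝓡 d) 𝓘(ℝ, Fib r →L[ℝ] Fib r) ∞ L x := by
    refine contMDiffAt_clm_of_apply fun v => ?_
    have h1 : ContMDiffAt (𝓡 d) ((𝓡 d).prod 𝓘(ℝ, Fib r)) ∞
        (fun y => (⟨y, tB.symm y v⟩ : B.Total)) x := by
      rw [tB.contMDiffAt_section_iff hxB]
      refine (contMDiffAt_const (c := v)).congr_of_eventuallyEq ?_
      filter_upwards [tB.open_baseSet.mem_nhds hxB] with y hy
      rw [tB.apply_mk_symm hy]
    have h2 := (R.smooth.contMDiffAt (x := ⟨x, tB.symm x v⟩)).comp x h1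
    have h3 := (tA.contMDiffAt_iff (tA.mem_source.2 hxA)).1 h2
    refine h3.2.congr_of_eventuallyEq ?_
    filter_upwards [hev] with y hy
    change tA.continuousLinearMapAt ℝ (i y) (R.app y (tB.symmL ℝ y v)) = _
    rw [← tA.coe_continuousLinearEquivAt_eq hy.2, tB.symmL_apply hy.1]
    rfl
  have hs : ContMDiffAt (𝓡 d) 𝓘(ℝ, Fib r) ∞ (fun y => (tA ⟨i y, s (i y)⟩).2) x :=
    ((tA.contMDiffAt_section_iff hxA).1 s.contMDiff.contMDiffAt).comp x hi.contMDiffAt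
  have hinv : ContMDiffAt (𝓡 d) 𝓘(ℝ, Fib r →L[ℝ] Fib r) ∞
      (fun y => ContinuousLinearMap.inverse (L y)) x := by
    have h := (contDiffAt_map_inverse (𝕜 := ℝ) (n := ∞) (e x hxB hxA)).contMDiffAt
    rw [heL] at h
    exact h.comp x hL
  rw [tB.contMDiffAt_section_iff hxB]
  refine (hinv.clm_apply hs).congr_of_eventuallyEq ?_
  filter_upwards [hev] with y hy
  rw [← heL y hy.1 hy.2, ContinuousLinearMap.inverse_equiv]
  have hB : (tB ⟨y, (R.app y).symm (s (i y))⟩).2 =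
      tB.continuousLinearEquivAt ℝ y hy.1 ((R.app y).symm (s (i y))) := rfl
  have hA : (tA ⟨i y, s (i y)⟩).2 = tA.continuousLinearEquivAt ℝ (i y) hy.2 (s (i y)) := rfl
  change (tB ⟨y, (R.app y).symm (s (i y))⟩).2 = (e y hy.1 hy.2).symm (tA ⟨i y, s (i y)⟩).2
  rw [hB, hA, ContinuousLinearEquiv.eq_symm_apply]
  simp [e, -Trivialization.continuousLinearEquivAt_apply]

end Restriction

/-! ### The action of an operator on the sections of a chain -/

section Gerbe

variable {d r : ℕ} {N : Type u} [TopologicalSpace N] [ChartedSpace (Model d) N]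

namespace RiemannianGerbe.Operator

variable {C : RiemannianGerbe.{u, v} d r N} {m : ℝ} (D : C.Operator m)

/-- If `s = s'` on a neighbourhood `V`, then the zero section over `V` is the restriction of `s -
s'`, so commutation with restriction makes `D (s - s')` vanish on `V`. -/
theorem isLocalOperator [IsManifold (𝓡 d) ∞ N] {U : Opens N} (e : C.Obj U) :
    IsLocalOperator (D.op e) := by
  intro s s' x hx
  obtain ⟨O, hO, hopen, hxO⟩ := eventually_nhds_iff.1 hx
  let V : Opens N := ⟨Subtype.val '' O, U.isOpen.isOpenMap_subtype_val O hopen⟩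
  have hV : V ≤ U := by
    rintro _ ⟨y, -, rfl⟩
    exact y.2
  have hxV : x.1 ∈ V := ⟨x, hxO, rfl⟩
  have h := D.comm_res hV e (s - s') 0 (fun y => by
    have hy : (⟨y.1, hV y.2⟩ : U) ∈ O := by
      obtain ⟨z, hz, hzy⟩ := y.2
      have : z = ⟨y.1, hV y.2⟩ := Subtype.ext hzy
      rwa [← this]
    have := hO _ hy
    simp [this]) ⟨x.1, hxV⟩
  simp only [map_zero, map_sub, ContMDiffSection.coe_zero, ContMDiffSection.coe_sub,
    Pi.zero_apply, Pi.sub_apply] at h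
  exact (sub_eq_zero.1 h.symm)

/-- On the overlap the gluing relation says that `g_ij` maps the restriction of `w j` to that of `w
i`. Commutation with restrictions and with the arrow carries this relation to the images under `D`.
-/
theorem map_mem_globalSections [IsManifold (𝓡 d) ∞ N] (G : C.Chain)
    {w : ∀ i, (C.bundle (G.e i)).Sections} (hw : w ∈ G.globalSections) :
    (fun i => D.op (G.e i) (w i)) ∈ G.globalSections := by
  intro i j x hi hj
  have hl : G.U i ⊓ G.U j ≤ G.U i := inf_le_left
  have hr : G.U i ⊓ G.U j ≤ G.U j := inf_le_right
  obtain ⟨ti, hti⟩ := (C.resIso hl (G.e i)).exists_restrict (w i)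
  obtain ⟨tj, htj⟩ := (C.resIso hr (G.e j)).exists_restrict (w j)
  have hij : ∀ y, ti y = (G.g i j).app y (tj y) := by
    intro y
    have h := hw i j y.1 (hl y.2) (hr y.2)
    rw [← hti, ← htj] at h
    simp only [BundlePrestack.onFiber, ContinuousLinearEquiv.trans_apply] at h
    have h' := ((C.resIso hl (G.e i)).app y).injective h
    simpa using h'
  have hD := D.comm_hom (G.g i j) (G.g_mem i j) tj ti hij ⟨x, hi, hj⟩
  have hDi := D.comm_res hl (G.e i) (w i) ti hti ⟨x, hi, hj⟩
  have hDj := D.comm_res hr (G.e j) (w j) tj htj ⟨x, hi, hj⟩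
  change D.op (G.e i) (w i) ⟨x, hi⟩ = C.onFiber hr hl (G.g i j) x ⟨hi, hj⟩
    (D.op (G.e j) (w j) ⟨x, hj⟩)
  rw [← hDi, ← hDj, hD]
  simp [BundlePrestack.onFiber]

/-- The operator induced on the smooth global sections of a chain. -/
def onGlobalSections [IsManifold (𝓡 d) ∞ N] (G : C.Chain) :
    G.globalSections →ₗ[ℝ] G.globalSections :=
  (LinearMap.pi fun i => D.op (G.e i) ∘ₗ LinearMap.proj i).restrict
    fun _ hw => D.map_mem_globalSections G hw

/-- The operator induced on the smooth global sections of a chain, endowed with the Sobolev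
topologies. -/
def onPreSobolev [IsManifold (𝓡 d) ∞ N] (G : C.Chain) (s : ℝ) :
    G.PreSobolev s →ₗ[ℝ] G.PreSobolev (s - m) :=
  D.onGlobalSections G

/-- The topology is initial for the localizations, and each seminorm of the image is bounded by a
single seminorm of the source, with the same index `i`. For an additive map continuity at zero is
enough. -/
theorem continuous_onPreSobolev [T2Space N] [IsManifold (𝓡 d) ∞ N] (G : C.Chain) (s : ℝ) :
    Continuous (D.onPreSobolev G s) := by
  refine continuous_induced_rng.2 (continuous_pi fun a => ?_)
  obtain ⟨a', c, hc⟩ := (D.pseudoDiff (G.e a.1)).exists_norm_bessel_le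
    (D.isLocalOperator (G.e a.1)) s a.2
  let F : G.PreSobolev s →+ L2 d r :=
    { toFun := fun w => bessel d r (s - m) (a.2.toSchwartz (D.op (G.e a.1) (w.1 a.1)))
      map_zero' := by
        change bessel d r (s - m) (a.2.toSchwartz (D.op (G.e a.1) 0)) = 0
        simp
      map_add' := fun w w' => by
        change bessel d r (s - m) (a.2.toSchwartz (D.op (G.e a.1) (w.1 a.1 + w'.1 a.1))) = _
        simp }
  change Continuous F
  refine continuous_of_continuousAt_zero F ?_
  have h0 : Continuous fun w : G.PreSobolev s => G.sobolevMap s w ⟨a.1, a'⟩ :=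
    (continuous_apply (⟨a.1, a'⟩ : G.Localizations)).comp continuous_induced_dom
  have h1 : Tendsto (fun w : G.PreSobolev s => c * ‖G.sobolevMap s w ⟨a.1, a'⟩‖) (𝓝 0) (𝓝 0) := by
    have h := (h0.norm.const_mul c).tendsto (0 : G.PreSobolev s)
    have hz : G.sobolevMap s (0 : G.PreSobolev s) = 0 := map_zero (G.sobolevMap s)
    simpa [hz] using h
  rw [ContinuousAt, map_zero]
  exact squeeze_zero_norm (fun w => hc (w.1 a.1)) h1

/-- The operator induced on the Sobolev space of a chain. -/
def onSobolev [T2Space N] [IsManifold (𝓡 d) ∞ N] (G : C.Chain) (s : ℝ) :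
    G.Sobolev s →L[ℝ] G.Sobolev (s - m) :=
  ContinuousLinearMap.completion
    { D.onPreSobolev G s with cont := D.continuous_onPreSobolev G s }

theorem onSobolev_toSobolev [T2Space N] [IsManifold (𝓡 d) ∞ N] (G : C.Chain) (s : ℝ)
    (w : G.globalSections) :
    D.onSobolev G s (G.toSobolev s w) = G.toSobolev (s - m) (D.onGlobalSections G w) :=
  ContinuousLinearMap.completion_apply_coe _ _

/-- Smooth global sections are dense in the completion, so their images determine a continuous map.
-/
theorem induces_iff [T2Space N] [IsManifold (𝓡 d) ∞ N] (G : C.Chain) (s : ℝ)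
    (T : G.Sobolev s →L[ℝ] G.Sobolev (s - m)) : D.Induces G s T ↔ T = D.onSobolev G s := by
  constructor
  · intro h
    refine DFunLike.coe_injective (UniformSpace.Completion.ext T.continuous
      (D.onSobolev G s).continuous fun w => ?_)
    obtain ⟨w', hw', e⟩ := h w
    have : w' = D.onGlobalSections G w := Subtype.ext (funext hw')
    subst this
    exact e.trans (D.onSobolev_toSobolev G s w).symm
  · rintro rfl w
    exact ⟨D.onGlobalSections G w, fun _ => rfl, D.onSobolev_toSobolev G s w⟩

end RiemannianGerbe.Operator

end Gerbe

end GerbeOp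

end

theorem proposition4 {d r : ℕ} {N : Type*} [TopologicalSpace N] [CompactSpace N] [T2Space N]
    [ChartedSpace (GerbeOp.Model d) N] [IsManifold (𝓡 d) ∞ N]
    (C : GerbeOp.RiemannianGerbe d r N) (n : ℝ) (D : C.Operator n) (s : ℝ) :
    (∀ G : C.Chain, ∃! T : G.Sobolev s →L[ℝ] G.Sobolev (s - n), D.Induces G s T) ∧
    ∃! T : C.FormalSobolev s →ₗ[ℝ] C.FormalSobolev (s - n),
      ∀ (G : C.Chain) (TG : G.Sobolev s →L[ℝ] G.Sobolev (s - n)), D.Induces G s TG →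
        ∀ x : G.Sobolev s, T (G.formal s x) = G.formal (s - n) (TG x) := by
  classical
  refine ⟨fun G => ⟨D.onSobolev G s, (D.induces_iff G s _).2 rfl,
    fun T hT => (D.induces_iff G s T).1 hT⟩, ?_⟩
  -- The operator acts on each summand by `onSobolev`, to which every continuous `TG` induced by `D`
  -- is equal.
  refine ⟨DirectSum.toModule ℝ C.Chain _ fun G =>
    G.formal (s - n) ∘ₗ (D.onSobolev G s).toLinearMap, ?_, ?_⟩
  · intro G TG hTG x
    obtain rfl := (D.induces_iff G s TG).1 hTG
    exact DirectSum.toModule_lof ℝ (M := fun G : C.Chain => G.Sobolev s)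
      (φ := fun G => G.formal (s - n) ∘ₗ (D.onSobolev G s).toLinearMap) G x
  · intro T hT
    refine DirectSum.linearMap_ext ℝ fun G => LinearMap.ext fun x => ?_
    refine (hT G _ ((D.induces_iff G s _).2 rfl) x).trans ?_
    exact (DirectSum.toModule_lof ℝ (M := fun G : C.Chain => G.Sobolev s)
      (φ := fun G => G.formal (s - n) ∘ₗ (D.onSobolev G s).toLinearMap) G x).symm
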